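/- Let $\Omega\subset\mathbb R^2$ be a bounded, connected, open polygonal set. A \emph{polygonal mesh} of $\Omega$ consists of a finite family $\mathcal T$ of pairwise disjoint open polygonal control volumes $K\subset\Omega$ with $\overline{\bigcup_{K\in\mathcal T}K}=\overline\Omega$, a point $\boldsymbol x_K\in K$ for each $K\in\mathcal T$ with respect to which $K$ is star-shaped (for instance, $K$ convex), and a finite family $\mathcal E=\mathcal E_{\rm int}\cup\mathcal E_{\rm ext}$ of pairwise disjoint, nondegenerate, relatively open line segments (edges) such that the boundary of each $K$ is $\bigcup_{\sigma\in\mathcal E_K}\overline\sigma$ for some $\mathcal E_K\subset\mathcal E$. Each interior edge $\sigma\in\mathcal E_{\rm int}$ lies in $\Omega$ and belongs to $\mathcal E_K$ for exactly two control volumes $K\ne L$, which is written $\sigma=K|L$; each $\sigma\in\mathcal E_{\rm ext}$ lies in $\partial\Omega$ and belongs to $\mathcal E_K$ for exactly one $K$. The segment $[\boldsymbol x_K,\boldsymbol x_L]$ need not be orthogonal to $K|L$. Let ${\rm m}_K$ be the area of $K$, ${\rm m}_\sigma$ the length of $\sigma$, and $d(\boldsymbol x,\sigma)$ the Euclidean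 distance from $\boldsymbol x$ to the line containing $\sigma$. Put ${\rm d}_\sigma=|\boldsymbol x_K-\boldsymbol x_L|$ if $\sigma=K|L\in\mathcal E_{\rm int}$, ${\rm d}_\sigma=d(\boldsymbol x_K,\sigma)$ if $\sigma\in\mathcal E_{\rm ext}\cap\mathcal E_K$, and $\tau_\sigma={\rm m}_\sigma/{\rm d}_\sigma$ for $\sigma\in\mathcal E_{\rm int}$. For $\zeta>0$, the mesh is \emph{$\zeta$-regular} if $d(\boldsymbol x_K,\sigma)\ge\zeta\,{\rm d}_\sigma$ for all $K\in\mathcal T$ and $\sigma\in\mathcal E_K$. For $s>0$, let $$\Phi_1(s)=s\log s-s+1,\qquad \Phi_p(s)=\frac{s^p-ps}{p-1}+1\quad(1<p\le 2).$$ There are constants $C_{LS}>0$ and $C_B>0$ depending only on $\Omega$ such that the following holds for every $\zeta>0$ and every $\zeta$-regular polygonal mesh of $\Omega$. Let $(v_K)_{K\in\mathcal T}$ and $(v_K^\infty)_{K\in\mathcal T}$ satisfy $v_K>0$ and $v_K^\infty>0$ for all $K\in\mathcal T$ and $$\sum_{K\in\mathcal T}{\rm m}_K v_K=\sum_{K\in\mathcal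 T}{\rm m}_K v_K^\infty=:M^1,$$ and let $M^\infty=\sup_{K\in\mathcal T}v_K^\infty$. Then $$\sum_{K\in\mathcal T}{\rm m}_K\,\Phi_1\!\left(\frac{v_K}{v_K^\infty}\right)v_K^\infty\ \le\ \frac{C_{LS}}{\zeta^2}\,(M^1M^\infty)^{1/2}\sum_{\sigma=K|L\in\mathcal E_{\rm int}}\tau_\sigma\left|\sqrt{\frac{v_K}{v_K^\infty}}-\sqrt{\frac{v_L}{v_L^\infty}}\right|^2,$$ and, for all $p\in(1,2]$, $$\sum_{K\in\mathcal T}{\rm m}_K\,\Phi_p\!\left(\frac{v_K}{v_K^\infty}\right)v_K^\infty\ \le\ \frac{C_B}{(p-1)\zeta}\,M^\infty\sum_{\sigma=K|L\in\mathcal E_{\rm int}}\tau_\sigma\left|\left(\frac{v_K}{v_K^\infty}\right)^{p/2}-\left(\frac{v_L}{v_L^\infty}\right)^{p/2}\right|^2.$$ -/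

import Mathlib

noncomputable section

namespace FiniteVolume

/-- The Euclidean plane `ℝ²`. -/
abbrev Plane : Type := EuclideanSpace ℝ (Fin 2)

/-- A set is polygonal when its topological boundary is a finite union of line segments. -/
def IsPolygonal (Ω : Set Plane) : Prop :=
  ∃ S : Set (Plane × Plane), S.Finite ∧ frontier Ω = ⋃ s ∈ S, segment ℝ s.1 s.2

/-- A (relatively open, nondegenerate) edge. -/
def IsEdge (σ : Set Plane) : Prop :=
  ∃ a b : Plane, a ≠ b ∧ σ = openSegment ℝ a b

/-- The length `m_σ`: the one-dimensional Hausdorff measure of the edge. -/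
def edgeLength (σ : Set Plane) : ℝ :=
  (MeasureTheory.Measure.hausdorffMeasure 1 σ).toReal

/-- `d(x, σ)`: the Euclidean distance between `x` and (its orthogonal projection on) the line
containing the edge `σ`. -/
def distToLine (x : Plane) (σ : Set Plane) : ℝ :=
  Metric.infDist x (affineSpan ℝ σ : Set Plane)

/-- A polygonal mesh of `Ω`: control volumes indexed by `T`, interior edges indexed by `Eint`,
boundary edges indexed by `Eext`, and one point in each control volume. No orthogonality between
the edges and the lines through neighbouring centers is required.

The interior edge `σ` separates the two control volumes `left σ` and `right σ`, that is
`σ = K|L` with `{K, L} = {left σ, right σ}` (the labels "left" and "right" carry no meaning);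
the boundary edge `σ` is an edge of the single control volume `owner σ`. -/
structure PolygonalMesh (Ω : Set Plane) (T Eint Eext : Type) where
  /-- the control volumes -/
  cell : T → Set Plane
  /-- the points `x_K` -/
  center : T → Plane
  /-- the interior edges -/
  inner : Eint → Set Plane
  /-- one of the two control volumes separated by an interior edge -/
  left : Eint → T
  /-- the other one -/
  right : Eint → T
  /-- the boundary edges -/
  outer : Eext → Set Plane
  /-- the control volume which has the given boundary edge -/
  owner : Eext → T
  isOpen_cell : ∀ K, IsOpen (cell K)
  cell_subset : ∀ K, cell K ⊆ Ω
  cell_disjoint : Pairwise fun K L => Disjoint (cell K) (cell L)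
  closure_iUnion_cell : closure (⋃ K, cell K) = closure Ω
  center_mem : ∀ K, center K ∈ cell K
  /-- Control volumes are star-shaped with respect to their centers (this holds as soon as they
  are convex). -/
  starConvex_cell : ∀ K, StarConvex ℝ (center K) (cell K)
  isEdge_inner : ∀ σ, IsEdge (inner σ)
  isEdge_outer : ∀ σ, IsEdge (outer σ)
  inner_subset : ∀ σ, inner σ ⊆ Ω
  outer_subset : ∀ σ, outer σ ⊆ frontier Ω
  inner_disjoint : Pairwise fun σ τ => Disjoint (inner σ) (inner τ)
  outer_disjoint : Pairwise fun σ τ => Disjoint (outer σ) (outer τ)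
  left_ne_right : ∀ σ, left σ ≠ right σ
  /-- The boundary of a control volume is the union of its closed edges. -/
  frontier_cell : ∀ K, frontier (cell K) =
    (⋃ σ ∈ {σ | left σ = K ∨ right σ = K}, closure (inner σ)) ∪
      ⋃ σ ∈ {σ | owner σ = K}, closure (outer σ)

namespace PolygonalMesh

variable {Ω : Set Plane} {T Eint Eext : Type}

/-- The area `m_K` of a control volume. -/
def area (M : PolygonalMesh Ω T Eint Eext) (K : T) : ℝ :=
  (MeasureTheory.volume (M.cell K)).toReal

/-- `d_σ = d(x_K, x_L)` for an interior edge `σ = K|L`. -/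
def dInner (M : PolygonalMesh Ω T Eint Eext) (σ : Eint) : ℝ :=
  dist (M.center (M.left σ)) (M.center (M.right σ))

/-- `d_σ = d(x_K, σ)` for a boundary edge `σ` of `K`. -/
def dOuter (M : PolygonalMesh Ω T Eint Eext) (σ : Eext) : ℝ :=
  distToLine (M.center (M.owner σ)) (M.outer σ)

/-- The transmissibility `τ_σ = m_σ / d_σ` of an interior edge. -/
def trans (M : PolygonalMesh Ω T Eint Eext) (σ : Eint) : ℝ :=
  edgeLength (M.inner σ) / M.dInner σ

/-- The regularity constraint: `d(x_K, σ) ≥ ζ d_σ` for every control volume `K` and every edge `σ`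
of `K`. -/
def IsRegular (M : PolygonalMesh Ω T Eint Eext) (ζ : ℝ) : Prop :=
  (∀ σ, ζ * M.dInner σ ≤ distToLine (M.center (M.left σ)) (M.inner σ) ∧
    ζ * M.dInner σ ≤ distToLine (M.center (M.right σ)) (M.inner σ)) ∧
  ∀ σ, ζ * M.dOuter σ ≤ distToLine (M.center (M.owner σ)) (M.outer σ)

/-- The sum `∑_{σ = K|L} τ_σ |f_K - f_L|²` over the interior edges. -/
def dirichletEnergy [Fintype Eint] (M : PolygonalMesh Ω T Eint Eext) (f : T → ℝ) : ℝ :=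
  ∑ σ : Eint, M.trans σ * |f (M.left σ) - f (M.right σ)| ^ 2

/-- The relative entropy `∑_K m_K Φ(v_K / w_K) w_K` of `v` with respect to `w`. -/
def relEntropy [Fintype T] (M : PolygonalMesh Ω T Eint Eext) (Φ : ℝ → ℝ) (v w : T → ℝ) : ℝ :=
  ∑ K : T, M.area K * Φ (v K / w K) * w K

end PolygonalMesh

/-- The Boltzmann entropy generator `Φ_1(s) = s log s - s + 1`. -/
def boltzmannPhi (s : ℝ) : ℝ := s * Real.log s - s + 1

/-- The Tsallis entropy generator `Φ_p(s) = (s^p - p s) / (p - 1) + 1`. -/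
def tsallisPhi (p s : ℝ) : ℝ := (s ^ p - p * s) / (p - 1) + 1

end FiniteVolume

end

/-!
The two entropies reduce to moments of `f - c`, where `f` is a power of `v / v^∞` and `c` is any
constant: for `1 < p ≤ 2` the Tsallis entropy is at most `(p - 1)⁻¹` times the second moment of
`(v / v^∞) ^ (p / 2) - c` (`sum_tsallisPhi_le`), and the Boltzmann entropy is at most a constant
times `(M¹)^{1/2}` times the square root of the fourth moment of `√(v / v^∞) - c`
(`sum_boltzmannPhi_le`), all moments being taken with weights `m_K v_K^∞ ≤ m_K M^∞`. It remains to
bound the norms of `f - c` in `L²(Ω)` and `L⁴(Ω)` by the discrete Dirichlet energy of `f`, with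
constants depending only on `Ω` (`exists_discrete_sobolev`).

Both bounds come from a single inequality, of type `BV(Ω) ⊆ L²(Ω)`
(`oscControlled_meshFamily`):
`∑_{K, L} m_K m_L |u_K - u_L|² ≤ C (∑_{σ = K|L} m_σ |u_K - u_L|)²`.
If `c` is a median of `f`, the left-hand side controls `∑ m_K u_K²` both for `u = f - c` and for
`u = (f - c) |f - c|`. On the right-hand side one uses the Cauchy–Schwarz inequality and
`ζ ∑_σ m_σ d_σ (g_K² + g_L²) ≤ C ∑_K m_K g_K²`. The latter holds because the triangles with apex
`x_K` over the edges of `K` lie in the closure of `K` and do not overlap, `K` being star-shaped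
(`sum_edgeLength_mul_distToLine_le`). The powers of `ζ` match because `ζ ≤ 1` as soon as there is an
interior edge, the centers of two neighbouring control volumes lying on opposite sides of their
common edge (`distToLine_le_dInner`).

The `BV` inequality is first proved on a parallelogram contained in `Ω`, by the argument of
Gagliardo and Nirenberg: one joins two points by two segments parallel to the sides, in the two
possible ways, and multiplies the two bounds (`oscControlled_meshFamily_openParallelogram`). Along
almost every line, which avoids the endpoints of the edges, a piecewise constant function only
jumps between the two control volumes separated by an interior edge (`abs_value_sub_value_le`).
Finally `Ω` is, up to a null set, a finite union of such parallelograms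
(`isParallelogramUnion_of_isPolygonal`), and its connectedness lets the inequality propagate from
each of them to `Ω` (`OscControlled.of_parallelograms`).
-/

namespace FiniteVolume

open MeasureTheory Set Filter Topology
open scoped ENNReal

/-! ### Planar cross product, triangles and lines -/

/-- The planar cross product `v ∧ w`, that is the determinant of the matrix with columns
`v` and `w`. -/
def cross (v w : Plane) : ℝ := v 0 * w 1 - v 1 * w 0

/-- The open triangle with vertices `A`, `B`, `C`, described by barycentric coordinates. -/
def openTriangle (A B C : Plane) : Set Plane :=
  {z | ∃ p q r : ℝ, 0 < p ∧ 0 < q ∧ 0 < r ∧ p + q + r = 1 ∧ z = p • A + q • B + r • C}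

/-- The open parallelogram with corner `o` and sides `a`, `b`. -/
def openParallelogram (o a b : Plane) : Set Plane :=
  {z | ∃ s t : ℝ, 0 < s ∧ s < 1 ∧ 0 < t ∧ t < 1 ∧ z = o + s • a + t • b}

lemma eq_smul_add_smul_of_cross_ne_zero {a b : Plane} (h : cross a b ≠ 0) (z : Plane) :
    z = (cross z b / cross a b) • a + (cross a z / cross a b) • b := by
  ext i
  fin_cases i <;>
  · simp only [PiLp.add_apply, PiLp.smul_apply, smul_eq_mul, Fin.zero_eta, Fin.mk_one]
    field_simp
    simp only [cross]
    ring

lemma continuous_cross_left (n : Plane) : Continuous fun z => cross n z := by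
  unfold cross; fun_prop

lemma left_ne_zero_of_cross_ne_zero {a b : Plane} (h : cross a b ≠ 0) : a ≠ 0 := by
  rintro rfl; exact h (by simp [cross])

lemma sq_add_sq_pos {n : Plane} (hn : n ≠ 0) : 0 < n 0 ^ 2 + n 1 ^ 2 := by
  by_contra h
  apply hn
  have h0 : n 0 = 0 := by nlinarith [sq_nonneg (n 0), sq_nonneg (n 1)]
  have h1 : n 1 = 0 := by nlinarith [sq_nonneg (n 0), sq_nonneg (n 1)]
  ext i; fin_cases i <;> simp [h0, h1]

lemma exists_cross_eq_sq_add_sq (n : Plane) : ∃ m : Plane, cross n m = n 0 ^ 2 + n 1 ^ 2 :=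
  ⟨!₂[-n 1, n 0], by simp [cross]; ring⟩

lemma exists_smul_of_cross_eq_zero {n w : Plane} (hn : n ≠ 0) (h : cross n w = 0) :
    ∃ t : ℝ, w = t • n := by
  have hp := sq_add_sq_pos hn
  refine ⟨(n 0 * w 0 + n 1 * w 1) / (n 0 ^ 2 + n 1 ^ 2), ?_⟩
  simp only [cross] at h
  ext i
  fin_cases i
  · simp only [PiLp.smul_apply, smul_eq_mul, Fin.zero_eta]
    field_simp
    linear_combination (- n 1) * h
  · simp only [PiLp.smul_apply, smul_eq_mul, Fin.mk_one]
    field_simp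
    linear_combination n 0 * h

/-- Lines are null sets. -/
lemma volume_line {n : Plane} (hn : n ≠ 0) (p : Plane) :
    volume {z : Plane | cross n (z - p) = 0} = 0 := by
  have hne : AffineSubspace.mk' p (Submodule.span ℝ {n}) ≠ ⊤ := by
    intro h
    obtain ⟨m, hm⟩ := exists_cross_eq_sq_add_sq n
    have : p + m ∈ AffineSubspace.mk' p (Submodule.span ℝ {n}) := by rw [h]; trivial
    rw [AffineSubspace.mem_mk', vsub_eq_sub, add_sub_cancel_left,
      Submodule.mem_span_singleton] at this
    obtain ⟨t, rfl⟩ := this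
    have := sq_add_sq_pos hn
    simp only [cross, PiLp.smul_apply, smul_eq_mul] at hm
    nlinarith
  refine measure_mono_null ?_ (Measure.addHaar_affineSubspace volume _ hne)
  intro z hz
  obtain ⟨t, ht⟩ := exists_smul_of_cross_eq_zero hn hz
  rw [SetLike.mem_coe, AffineSubspace.mem_mk', vsub_eq_sub, Submodule.mem_span_singleton]
  exact ⟨t, ht.symm⟩

lemma segment_subset_line (a b : Plane) : segment ℝ a b ⊆ {z | cross (b - a) (z - a) = 0} := by
  rintro z ⟨p, q, -, -, hpq, rfl⟩
  obtain rfl : p = 1 - q := by linarith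
  simp only [mem_ofPred_eq, cross, PiLp.sub_apply, PiLp.add_apply, PiLp.smul_apply, smul_eq_mul]
  ring

lemma volume_segment {a b : Plane} (h : a ≠ b) : volume (segment ℝ a b) = 0 :=
  measure_mono_null (segment_subset_line a b) (volume_line (sub_ne_zero.2 h.symm) a)

lemma cross_sub_barycenter (n x A B C : Plane) {p q r : ℝ} (h : p + q + r = 1) :
    cross n (p • A + q • B + r • C - x) =
      p * cross n (A - x) + q * cross n (B - x) + r * cross n (C - x) := by
  obtain rfl : p = 1 - q - r := by linarith
  simp only [cross, PiLp.sub_apply, PiLp.add_apply, PiLp.smul_apply, smul_eq_mul]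
  ring

lemma openTriangle_rotate (A B C : Plane) : openTriangle A B C = openTriangle B C A := by
  ext z
  constructor
  · rintro ⟨p, q, r, hp, hq, hr, h, rfl⟩
    exact ⟨q, r, p, hq, hr, hp, by linarith, by abel⟩
  · rintro ⟨p, q, r, hp, hq, hr, h, rfl⟩
    exact ⟨r, p, q, hr, hp, hq, by linarith, by abel⟩

/-- Cutting a triangle along the segment from the vertex `C` to a point of the side `AB`. -/
lemma openTriangle_split {A B C : Plane} (h : cross (B - A) (C - A) ≠ 0) {l : ℝ} (h0 : 0 < l)
    (h1 : l < 1) :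
    let D := (1 - l) • A + l • B
    cross (D - A) (C - A) ≠ 0 ∧ cross (B - D) (C - D) ≠ 0 ∧
    openTriangle A D C ⊆ openTriangle A B C ∧ openTriangle D B C ⊆ openTriangle A B C ∧
      volume (openTriangle A B C \ (openTriangle A D C ∪ openTriangle D B C)) = 0 := by
  intro D
  have h1' : 0 < 1 - l := by linarith
  have e1 : cross (D - A) (C - A) = l * cross (B - A) (C - A) := by
    simp only [D, cross, PiLp.sub_apply, PiLp.add_apply, PiLp.smul_apply, smul_eq_mul]; ring
  have e2 : cross (B - D) (C - D) = (1 - l) * cross (B - A) (C - A) := by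
    simp only [D, cross, PiLp.sub_apply, PiLp.add_apply, PiLp.smul_apply, smul_eq_mul]; ring
  have hCD : C - D ≠ 0 := by
    intro hc
    rw [hc] at e2
    have : cross (B - D) 0 = 0 := by simp [cross]
    rw [this] at e2
    exact mul_ne_zero h1'.ne' h e2.symm
  refine ⟨by rw [e1]; positivity, by rw [e2]; positivity, ?_, ?_, ?_⟩
  · rintro z ⟨p, q, r, hp, hq, hr, hs, rfl⟩
    refine ⟨p + q * (1 - l), q * l, r, by positivity, by positivity, hr, by linarith, ?_⟩
    simp only [D]; module
  · rintro z ⟨p, q, r, hp, hq, hr, hs, rfl⟩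
    refine ⟨p * (1 - l), q + p * l, r, by positivity, by positivity, hr, by linarith, ?_⟩
    simp only [D]; module
  · refine measure_mono_null ?_ (volume_line hCD D)
    rintro z ⟨⟨p, q, r, hp, hq, hr, hs, rfl⟩, hz⟩
    rw [mem_union, not_or] at hz
    obtain ⟨hz1, hz2⟩ := hz
    rcases lt_trichotomy ((1 - l) * q) (l * p) with hlt | heq | hgt
    · exfalso
      apply hz1
      refine ⟨p - (1 - l) * q / l, q / l, r, ?_, by positivity, hr, ?_, ?_⟩
      · rw [sub_pos, div_lt_iff₀ h0]; linarith
      · field_simp; linear_combination l * hs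
      · have e3 : q = q / l * l := by field_simp
        have e4 : (1 - l) * q / l = q / l * (1 - l) := by ring
        rw [e4]
        nth_rw 1 [e3]
        simp only [D]; module
    · obtain ⟨s, rfl, rfl⟩ : ∃ s, p = (1 - l) * s ∧ q = l * s :=
        ⟨p + q, by linarith, by linarith⟩
      obtain rfl : r = 1 - s := by linarith
      simp only [mem_ofPred_eq, D, cross, PiLp.sub_apply, PiLp.add_apply, PiLp.smul_apply,
        smul_eq_mul]
      ring
    · exfalso
      apply hz2
      refine ⟨p / (1 - l), q - l * p / (1 - l), r, by positivity, ?_, hr, ?_, ?_⟩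
      · rw [sub_pos, div_lt_iff₀ h1']; linarith
      · field_simp; linear_combination (1 - l) * hs
      · have e3 : p = p / (1 - l) * (1 - l) := by field_simp
        have e4 : l * p / (1 - l) = p / (1 - l) * l := by ring
        rw [e4]
        nth_rw 1 [e3]
        simp only [D]; module

/-! ### Cutting a polygonal set into parallelograms -/

lemma cross_rotate (A B C : Plane) : cross (C - B) (A - B) = cross (B - A) (C - A) := by
  simp only [cross, PiLp.sub_apply]; ring

lemma cross_ne_zero_of_mem_openTriangle {A B C n x : Plane} (h : cross (B - A) (C - A) ≠ 0)
    (hn : n ≠ 0)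
    (hs : (0 ≤ cross n (A - x) ∧ 0 ≤ cross n (B - x) ∧ 0 ≤ cross n (C - x)) ∨
      (cross n (A - x) ≤ 0 ∧ cross n (B - x) ≤ 0 ∧ cross n (C - x) ≤ 0))
    {z : Plane} (hz : z ∈ openTriangle A B C) : cross n (z - x) ≠ 0 := by
  obtain ⟨p, q, r, hp, hq, hr, hpqr, rfl⟩ := hz
  rw [cross_sub_barycenter _ _ _ _ _ hpqr]
  intro h0
  have key : cross n (A - x) = 0 ∧ cross n (B - x) = 0 ∧ cross n (C - x) = 0 := by
    rcases hs with ⟨ha, hb, hc⟩ | ⟨ha, hb, hc⟩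
    · have h1 := mul_nonneg hp.le ha
      have h2 := mul_nonneg hq.le hb
      have h3 := mul_nonneg hr.le hc
      refine ⟨?_, ?_, ?_⟩
      · exact (mul_eq_zero.1 (show p * cross n (A - x) = 0 by linarith)).resolve_left hp.ne'
      · exact (mul_eq_zero.1 (show q * cross n (B - x) = 0 by linarith)).resolve_left hq.ne'
      · exact (mul_eq_zero.1 (show r * cross n (C - x) = 0 by linarith)).resolve_left hr.ne'
    · have h1 := mul_nonpos_of_nonneg_of_nonpos hp.le ha
      have h2 := mul_nonpos_of_nonneg_of_nonpos hq.le hb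
      have h3 := mul_nonpos_of_nonneg_of_nonpos hr.le hc
      refine ⟨?_, ?_, ?_⟩
      · exact (mul_eq_zero.1 (show p * cross n (A - x) = 0 by linarith)).resolve_left hp.ne'
      · exact (mul_eq_zero.1 (show q * cross n (B - x) = 0 by linarith)).resolve_left hq.ne'
      · exact (mul_eq_zero.1 (show r * cross n (C - x) = 0 by linarith)).resolve_left hr.ne'
  obtain ⟨ka, kb, kc⟩ := key
  have hB : cross n (B - A) = 0 := by
    simp only [cross, PiLp.sub_apply] at ka kb ⊢; linarith
  have hC : cross n (C - A) = 0 := by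
    simp only [cross, PiLp.sub_apply] at ka kc ⊢; linarith
  obtain ⟨s, hs⟩ := exists_smul_of_cross_eq_zero hn hB
  obtain ⟨t, ht⟩ := exists_smul_of_cross_eq_zero hn hC
  apply h
  rw [hs, ht]
  simp only [cross, PiLp.smul_apply, smul_eq_mul]; ring

lemma exists_convex_comb_eq_zero {β γ : ℝ} (h : β * γ < 0) :
    ∃ l : ℝ, 0 < l ∧ l < 1 ∧ (1 - l) * β + l * γ = 0 := by
  have hβγ : β - γ ≠ 0 := by
    intro h0
    have : β = γ := by linarith
    rw [this] at h; nlinarith [mul_self_nonneg γ]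
  refine ⟨β / (β - γ), ?_, ?_, by field_simp; ring⟩
  · rcases mul_neg_iff.1 h with ⟨hb, hc⟩ | ⟨hb, hc⟩
    · exact div_pos hb (by linarith)
    · exact div_pos_of_neg_of_neg hb (by linarith)
  · rcases mul_neg_iff.1 h with ⟨hb, hc⟩ | ⟨hb, hc⟩
    · rw [div_lt_one (by linarith)]; linarith
    · rw [div_lt_one_of_neg (by linarith)]; linarith

section Cutting

variable {R : Set Plane → Prop}

/-- A property which passes to almost everywhere unions holds for a triangle with a vertex on a
line as soon as it holds for the subtriangles avoiding that line. -/
lemma of_subtriangles_of_vertex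
    (hR : ∀ S S₁ S₂, S₁ ⊆ S → S₂ ⊆ S → volume (S \ (S₁ ∪ S₂)) = 0 → R S₁ → R S₂ → R S)
    {n x : Plane} (hn : n ≠ 0) {A B C : Plane} (h : cross (B - A) (C - A) ≠ 0)
    (hA : cross n (A - x) = 0)
    (H : ∀ A' B' C', cross (B' - A') (C' - A') ≠ 0 → openTriangle A' B' C' ⊆ openTriangle A B C →
      (∀ z ∈ openTriangle A' B' C', cross n (z - x) ≠ 0) → R (openTriangle A' B' C')) :
    R (openTriangle A B C) := by
  by_cases hBC : 0 ≤ cross n (B - x) * cross n (C - x)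
  · refine H A B C h subset_rfl fun z hz => cross_ne_zero_of_mem_openTriangle h hn ?_ hz
    rcases mul_nonneg_iff.1 hBC with h' | h'
    · exact Or.inl ⟨hA.ge, h'⟩
    · exact Or.inr ⟨hA.le, h'⟩
  · push Not at hBC
    set β := cross n (B - x)
    set γ := cross n (C - x)
    have h' : cross (C - B) (A - B) ≠ 0 := by rwa [cross_rotate]
    obtain ⟨l, hl0, hl1, hl⟩ := exists_convex_comb_eq_zero hBC
    obtain ⟨d1, d2, s1, s2, hv⟩ := openTriangle_split h' hl0 hl1
    set E := (1 - l) • B + l • C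
    have hE : cross n (E - x) = 0 := by
      have := cross_sub_barycenter n x B C 0 (p := 1 - l) (q := l) (r := 0) (by ring)
      rw [← hl]
      simpa using this
    rw [openTriangle_rotate]
    rw [openTriangle_rotate] at H
    refine hR _ _ _ s1 s2 hv (H _ _ _ d1 s1 fun z hz =>
      cross_ne_zero_of_mem_openTriangle d1 hn ?_ hz) (H _ _ _ d2 s2 fun z hz =>
      cross_ne_zero_of_mem_openTriangle d2 hn ?_ hz)
    · rw [hE, hA]
      rcases le_total 0 β with hb | hb
      · exact Or.inl ⟨hb, le_rfl, le_rfl⟩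
      · exact Or.inr ⟨hb, le_rfl, le_rfl⟩
    · rw [hE, hA]
      rcases le_total 0 γ with hb | hb
      · exact Or.inl ⟨le_rfl, hb, le_rfl⟩
      · exact Or.inr ⟨le_rfl, hb, le_rfl⟩

lemma of_subtriangles_of_opposite
    (hR : ∀ S S₁ S₂, S₁ ⊆ S → S₂ ⊆ S → volume (S \ (S₁ ∪ S₂)) = 0 → R S₁ → R S₂ → R S)
    {n x : Plane} (hn : n ≠ 0) {A B C : Plane} (h : cross (B - A) (C - A) ≠ 0)
    (hAB : cross n (A - x) * cross n (B - x) < 0)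
    (H : ∀ A' B' C', cross (B' - A') (C' - A') ≠ 0 → openTriangle A' B' C' ⊆ openTriangle A B C →
      (∀ z ∈ openTriangle A' B' C', cross n (z - x) ≠ 0) → R (openTriangle A' B' C')) :
    R (openTriangle A B C) := by
  set β := cross n (A - x)
  set γ := cross n (B - x)
  obtain ⟨l, hl0, hl1, hl⟩ := exists_convex_comb_eq_zero hAB
  obtain ⟨d1, d2, s1, s2, hv⟩ := openTriangle_split h hl0 hl1
  set E := (1 - l) • A + l • B
  have hE : cross n (E - x) = 0 := by
    have := cross_sub_barycenter n x A B 0 (p := 1 - l) (q := l) (r := 0) (by ring)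
    rw [← hl]
    simpa using this
  refine hR _ _ _ s1 s2 hv ?_ ?_
  · rw [openTriangle_rotate] at s1 ⊢
    rw [← cross_rotate] at d1
    exact of_subtriangles_of_vertex hR hn d1 hE fun A' B' C' d s => H A' B' C' d (s.trans s1)
  · exact of_subtriangles_of_vertex hR hn d2 hE fun A' B' C' d s => H A' B' C' d (s.trans s2)

lemma of_subtriangles
    (hR : ∀ S S₁ S₂, S₁ ⊆ S → S₂ ⊆ S → volume (S \ (S₁ ∪ S₂)) = 0 → R S₁ → R S₂ → R S)
    {n x : Plane} (hn : n ≠ 0) {A B C : Plane} (h : cross (B - A) (C - A) ≠ 0)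
    (H : ∀ A' B' C', cross (B' - A') (C' - A') ≠ 0 → openTriangle A' B' C' ⊆ openTriangle A B C →
      (∀ z ∈ openTriangle A' B' C', cross n (z - x) ≠ 0) → R (openTriangle A' B' C')) :
    R (openTriangle A B C) := by
  have h₁ : cross (C - B) (A - B) ≠ 0 := by rwa [cross_rotate]
  have h₂ : cross (A - C) (B - C) ≠ 0 := by rwa [cross_rotate]
  by_cases hAB : cross n (A - x) * cross n (B - x) < 0
  · exact of_subtriangles_of_opposite hR hn h hAB H
  by_cases hBC : cross n (B - x) * cross n (C - x) < 0
  · rw [openTriangle_rotate] at H ⊢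
    exact of_subtriangles_of_opposite hR hn h₁ hBC H
  by_cases hCA : cross n (C - x) * cross n (A - x) < 0
  · rw [openTriangle_rotate, openTriangle_rotate] at H ⊢
    exact of_subtriangles_of_opposite hR hn h₂ hCA H
  refine H A B C h subset_rfl fun z hz => cross_ne_zero_of_mem_openTriangle h hn ?_ hz
  push Not at hAB hBC hCA
  generalize cross n (A - x) = a at *
  generalize cross n (B - x) = b at *
  generalize cross n (C - x) = c at *
  by_contra hcon
  push Not at hcon
  obtain ⟨c1, c2⟩ := hcon
  rcases lt_trichotomy a 0 with ha | ha | ha <;> rcases lt_trichotomy b 0 with hb | hb | hb <;>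
    rcases lt_trichotomy c 0 with hc | hc | hc <;> first
    | nlinarith | (have := c1 (by linarith) (by linarith); nlinarith)
    | (have := c2 (by linarith) (by linarith); nlinarith)

/-- Iterated cutting: a property which passes to almost everywhere unions holds for a triangle as
soon as it holds for the subtriangles avoiding a given finite family of lines. -/
lemma of_subtriangles_list
    (hR : ∀ S S₁ S₂, S₁ ⊆ S → S₂ ⊆ S → volume (S \ (S₁ ∪ S₂)) = 0 → R S₁ → R S₂ → R S)
    (L : List (Plane × Plane)) (hL : ∀ l ∈ L, l.1 ≠ 0) :
    ∀ A B C : Plane, cross (B - A) (C - A) ≠ 0 →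
    (∀ A' B' C', cross (B' - A') (C' - A') ≠ 0 → openTriangle A' B' C' ⊆ openTriangle A B C →
      (∀ l ∈ L, ∀ z ∈ openTriangle A' B' C', cross l.1 (z - l.2) ≠ 0) →
      R (openTriangle A' B' C')) → R (openTriangle A B C) := by
  induction L with
  | nil => exact fun A B C h H => H A B C h subset_rfl (by simp)
  | cons l L ih =>
    intro A B C h H
    refine of_subtriangles hR (hL l (by simp)) (x := l.2) h fun A' B' C' h' s' hl => ?_
    refine ih (fun l hl => hL l (by simp [hl])) A' B' C' h' fun A'' B'' C'' h'' s'' hL'' => ?_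
    refine H A'' B'' C'' h'' (s''.trans s') ?_
    intro m hm z hz
    rcases List.mem_cons.1 hm with rfl | hm
    · exact hl z (s'' hz)
    · exact hL'' m hm z hz

end Cutting

/-- `S` is, up to a null set, a finite union of nondegenerate open parallelograms. -/
def IsParallelogramUnion (S : Set Plane) : Prop :=
  ∃ F : Set (Plane × Plane × Plane), F.Finite ∧
    (∀ t ∈ F, cross t.2.1 t.2.2 ≠ 0 ∧ openParallelogram t.1 t.2.1 t.2.2 ⊆ S) ∧
    volume (S \ ⋃ t ∈ F, openParallelogram t.1 t.2.1 t.2.2) = 0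

lemma IsParallelogramUnion.of_union {S S₁ S₂ : Set Plane} (h₁ : S₁ ⊆ S) (h₂ : S₂ ⊆ S)
    (hv : volume (S \ (S₁ ∪ S₂)) = 0) (H₁ : IsParallelogramUnion S₁)
    (H₂ : IsParallelogramUnion S₂) : IsParallelogramUnion S := by
  obtain ⟨F₁, f₁, s₁, v₁⟩ := H₁
  obtain ⟨F₂, f₂, s₂, v₂⟩ := H₂
  refine ⟨F₁ ∪ F₂, f₁.union f₂, ?_, ?_⟩
  · rintro t (ht | ht)
    · exact ⟨(s₁ t ht).1, (s₁ t ht).2.trans h₁⟩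
    · exact ⟨(s₂ t ht).1, (s₂ t ht).2.trans h₂⟩
  · refine measure_mono_null ?_ (measure_union_null (measure_union_null hv v₁) v₂)
    rintro z ⟨hz, hn⟩
    rw [biUnion_union, mem_union, not_or] at hn
    by_cases h1 : z ∈ S₁
    · exact Or.inl (Or.inr ⟨h1, hn.1⟩)
    by_cases h2 : z ∈ S₂
    · exact Or.inr ⟨h2, hn.2⟩
    · exact Or.inl (Or.inl ⟨hz, by simp [h1, h2]⟩)

lemma isParallelogramUnion_empty : IsParallelogramUnion ∅ :=
  ⟨∅, finite_empty, by simp, by simp⟩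

lemma openParallelogram_subset_openTriangle (A B C : Plane) :
    openParallelogram A ((1 / 2 : ℝ) • (B - A)) ((1 / 2 : ℝ) • (C - A)) ⊆ openTriangle A B C := by
  rintro z ⟨s, t, hs, hs', ht, ht', rfl⟩
  exact ⟨1 - s / 2 - t / 2, s / 2, t / 2, by linarith, by linarith, by linarith, by ring, by module⟩

lemma mem_openParallelogram_of_barycentric {A B C : Plane} {p q r : ℝ} (hq : 0 < q) (hr : 0 < r)
    (hq' : q < 1 / 2) (hr' : r < 1 / 2) (h : p + q + r = 1) :
    p • A + q • B + r • C ∈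
      openParallelogram A ((1 / 2 : ℝ) • (B - A)) ((1 / 2 : ℝ) • (C - A)) := by
  obtain rfl : p = 1 - q - r := by linarith
  exact ⟨2 * q, 2 * r, by linarith, by linarith, by linarith, by linarith, by module⟩

/-- A triangle is the union of the three half-size parallelograms at its corners, since at most
one barycentric coordinate is at least `1 / 2`. -/
lemma isParallelogramUnion_openTriangle {A B C : Plane} (h : cross (B - A) (C - A) ≠ 0) :
    IsParallelogramUnion (openTriangle A B C) := by
  have h₁ : cross (C - B) (A - B) ≠ 0 := by rwa [cross_rotate]
  have h₂ : cross (A - C) (B - C) ≠ 0 := by rwa [cross_rotate]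
  have hhalf : ∀ v w : Plane, cross v w ≠ 0 → cross ((1 / 2 : ℝ) • v) ((1 / 2 : ℝ) • w) ≠ 0 := by
    intro v w hvw
    have : cross ((1 / 2 : ℝ) • v) ((1 / 2 : ℝ) • w) = 1 / 4 * cross v w := by
      simp only [cross, PiLp.smul_apply, smul_eq_mul]; ring
    rw [this]; positivity
  refine ⟨{(A, (1 / 2 : ℝ) • (B - A), (1 / 2 : ℝ) • (C - A)),
    (B, (1 / 2 : ℝ) • (C - B), (1 / 2 : ℝ) • (A - B)),
    (C, (1 / 2 : ℝ) • (A - C), (1 / 2 : ℝ) • (B - C))}, by simp, ?_, ?_⟩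
  · rintro t (rfl | rfl | rfl)
    · exact ⟨hhalf _ _ h, openParallelogram_subset_openTriangle A B C⟩
    · refine ⟨hhalf _ _ h₁, ?_⟩
      rw [openTriangle_rotate]; exact openParallelogram_subset_openTriangle B C A
    · refine ⟨hhalf _ _ h₂, ?_⟩
      rw [openTriangle_rotate, openTriangle_rotate]
      exact openParallelogram_subset_openTriangle C A B
  · convert measure_empty (μ := (volume : Measure Plane))
    rw [sdiff_eq_empty]
    rintro z ⟨p, q, r, hp, hq, hr, hs, rfl⟩
    simp only [mem_iUnion, exists_prop, mem_insert_iff, mem_singleton_iff, exists_eq_or_imp,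
      exists_eq_left]
    by_cases hq' : q < 1 / 2
    · by_cases hr' : r < 1 / 2
      · exact Or.inl (mem_openParallelogram_of_barycentric hq hr hq' hr' hs)
      · refine Or.inr (Or.inr ?_)
        rw [show p • A + q • B + r • C = r • C + p • A + q • B by abel]
        exact mem_openParallelogram_of_barycentric hp hq (by linarith) hq' (by linarith)
    · refine Or.inr (Or.inl ?_)
      rw [show p • A + q • B + r • C = q • B + r • C + p • A by abel]
      exact mem_openParallelogram_of_barycentric hr hp (by linarith) (by linarith) (by linarith)

lemma convex_openTriangle (A B C : Plane) : Convex ℝ (openTriangle A B C) := by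
  rintro _ ⟨p, q, r, hp, hq, hr, hs, rfl⟩ _ ⟨p', q', r', hp', hq', hr', hs', rfl⟩ a b ha hb hab
  obtain rfl : a = 1 - b := by linarith
  have key : ∀ u v : ℝ, 0 < u → 0 < v → 0 < (1 - b) * u + b * v := by
    intro u v hu hv
    rcases hb.eq_or_lt with rfl | hb
    · simpa using hu
    · have := mul_nonneg ha hu.le
      have := mul_pos hb hv
      linarith
  refine ⟨(1 - b) * p + b * p', (1 - b) * q + b * q', (1 - b) * r + b * r', key _ _ hp hp',
    key _ _ hq hq', key _ _ hr hr', by linear_combination (1 - b) * hs + b * hs', by module⟩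

/-- A bounded open polygonal set is almost everywhere a finite union of parallelograms: cut a large
triangle along all the lines carrying a boundary segment. -/
lemma isParallelogramUnion_of_isPolygonal {Ω : Set Plane} (hΩ : IsOpen Ω)
    (hb : Bornology.IsBounded Ω) (hp : IsPolygonal Ω) : IsParallelogramUnion Ω := by
  obtain ⟨S, hS, hfr⟩ := hp
  obtain ⟨ρ, hρ⟩ := hb.subset_closedBall 0
  classical
  -- a direction for each segment, any one if the segment is reduced to a point
  let dir : Plane × Plane → Plane := fun s => if s.1 = s.2 then !₂[1, 0] else s.2 - s.1
  have hdir : ∀ s, dir s ≠ 0 := by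
    intro s
    by_cases h : s.1 = s.2
    · simp only [dir, h, if_true]
      intro h0
      have := congrArg (fun v : Plane => v 0) h0
      simp at this
    · simpa only [dir, h, if_false] using sub_ne_zero.2 (Ne.symm h)
  let L : List (Plane × Plane) := hS.toFinset.toList.map fun s => (dir s, s.1)
  obtain ⟨A, B, C, hABC, hsub⟩ : ∃ A B C : Plane, cross (B - A) (C - A) ≠ 0 ∧
      Ω ⊆ openTriangle A B C := by
    set d := |ρ| + 1
    have hd : 0 < d := by positivity
    refine ⟨!₂[-d, -d], !₂[3 * d, -d], !₂[-d, 3 * d], ?_, ?_⟩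
    · simp [cross]; linarith
    · intro z hz
      have hn : ‖z‖ ≤ ρ := by simpa using hρ hz
      have h0 : |z 0| ≤ ρ := (PiLp.norm_apply_le z 0).trans hn
      have h1 : |z 1| ≤ ρ := (PiLp.norm_apply_le z 1).trans hn
      have hρd : ρ < d := by have := le_abs_self ρ; simp only [d]; linarith
      rw [abs_le] at h0 h1
      refine ⟨1 - (z 0 + d) / (4 * d) - (z 1 + d) / (4 * d), (z 0 + d) / (4 * d),
        (z 1 + d) / (4 * d), ?_, ?_, ?_, by ring, ?_⟩
      · rw [sub_sub, ← add_div, sub_pos, div_lt_one (by positivity)]; linarith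
      · apply div_pos <;> linarith
      · apply div_pos <;> linarith
      · ext i
        fin_cases i
        · simp; field_simp; ring
        · simp; field_simp; ring
  have hmain : IsParallelogramUnion (Ω ∩ openTriangle A B C) := by
    refine of_subtriangles_list (R := fun S => IsParallelogramUnion (Ω ∩ S)) ?_ L ?_ A B C hABC ?_
    · intro S S₁ S₂ h₁ h₂ hv H₁ H₂
      refine H₁.of_union (inter_subset_inter_right _ h₁) (inter_subset_inter_right _ h₂)
        (measure_mono_null ?_ hv) H₂
      rintro z ⟨⟨hz, hzS⟩, hn⟩
      refine ⟨hzS, fun h => hn ?_⟩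
      exact h.imp (fun h => ⟨hz, h⟩) (fun h => ⟨hz, h⟩)
    · intro l hl
      obtain ⟨s, -, rfl⟩ := List.mem_map.1 hl
      exact hdir s
    · intro A' B' C' h' _ hL
      have hdisj : ∀ z ∈ openTriangle A' B' C', z ∉ frontier Ω := by
        intro z hz hzf
        rw [hfr] at hzf
        simp only [mem_iUnion, exists_prop] at hzf
        obtain ⟨s, hs, hzs⟩ := hzf
        refine hL (dir s, s.1) (List.mem_map.2 ⟨s, by simpa using hs, rfl⟩) z hz ?_
        by_cases h : s.1 = s.2
        · rw [h, segment_same, mem_singleton_iff] at hzs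
          simp [cross, h, hzs]
        · have : cross (s.2 - s.1) (z - s.1) = 0 := segment_subset_line _ _ hzs
          simpa only [dir, h, if_false] using this
      by_cases hne : (openTriangle A' B' C' ∩ Ω).Nonempty
      · have : openTriangle A' B' C' ⊆ Ω := by
          refine (convex_openTriangle _ _ _).isPreconnected.subset_of_closure_inter_subset hΩ hne ?_
          rintro z ⟨hzc, hz⟩
          by_contra hzΩ
          exact hdisj z hz (by rw [hΩ.frontier_eq]; exact ⟨hzc, hzΩ⟩)
        rw [inter_eq_right.2 this]
        exact isParallelogramUnion_openTriangle h'
      · rw [inter_comm, not_nonempty_iff_eq_empty.1 hne]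
        exact isParallelogramUnion_empty
  rwa [inter_eq_left.2 hsub] at hmain

/-! ### Oscillation and its propagation through a connected set -/

lemma mem_openParallelogram_iff {o a b : Plane} (h : cross a b ≠ 0) (z : Plane) :
    z ∈ openParallelogram o a b ↔ (0 < cross (z - o) b / cross a b ∧ cross (z - o) b / cross a b < 1) ∧
      0 < cross a (z - o) / cross a b ∧ cross a (z - o) / cross a b < 1 := by
  constructor
  · rintro ⟨s, t, hs, hs', ht, ht', rfl⟩
    have e1 : cross (o + s • a + t • b - o) b / cross a b = s := by
      rw [div_eq_iff h]
      simp only [cross, PiLp.sub_apply, PiLp.add_apply, PiLp.smul_apply, smul_eq_mul]; ring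
    have e2 : cross a (o + s • a + t • b - o) / cross a b = t := by
      rw [div_eq_iff h]
      simp only [cross, PiLp.sub_apply, PiLp.add_apply, PiLp.smul_apply, smul_eq_mul]; ring
    rw [e1, e2]
    exact ⟨⟨hs, hs'⟩, ht, ht'⟩
  · rintro ⟨⟨h1, h2⟩, h3, h4⟩
    refine ⟨_, _, h1, h2, h3, h4, ?_⟩
    have := eq_smul_add_smul_of_cross_ne_zero h (z - o)
    rw [add_assoc, ← this]; abel

lemma isOpen_openParallelogram {o a b : Plane} (h : cross a b ≠ 0) :
    IsOpen (openParallelogram o a b) := by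
  have : openParallelogram o a b =
      {z | (0 < cross (z - o) b / cross a b ∧ cross (z - o) b / cross a b < 1) ∧
      0 < cross a (z - o) / cross a b ∧ cross a (z - o) / cross a b < 1} := by
    ext z; exact mem_openParallelogram_iff h z
  rw [this]
  have c1 : Continuous fun z : Plane => cross (z - o) b / cross a b := by unfold cross; fun_prop
  have c2 : Continuous fun z : Plane => cross a (z - o) / cross a b := by unfold cross; fun_prop
  exact ((isOpen_lt continuous_const c1).inter (isOpen_lt c1 continuous_const)).inter
    ((isOpen_lt continuous_const c2).inter (isOpen_lt c2 continuous_const))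

/-- The mean square oscillation `∫_A ∫_B (f z - f w)² dw dz`, with values in `[0, ∞]`. -/
noncomputable def oscillation (f : Plane → ℝ) (A B : Set Plane) : ℝ≥0∞ :=
  ∫⁻ z in A, ∫⁻ w in B, ENNReal.ofReal ((f z - f w) ^ 2)

/-- The oscillation of `f` between `A` and `B` is bounded by `V`, up to a constant, uniformly over
all the pairs `(f, V)` of the family `𝓕`. -/
def OscControlled (𝓕 : Set ((Plane → ℝ) × ℝ≥0∞)) (A B : Set Plane) : Prop :=
  ∃ C : ℝ≥0∞, C ≠ ⊤ ∧ ∀ F ∈ 𝓕, oscillation F.1 A B ≤ C * F.2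

lemma measurable_oscillation_integrand {f : Plane → ℝ} (hf : Measurable f) :
    Measurable fun p : Plane × Plane => ENNReal.ofReal ((f p.1 - f p.2) ^ 2) := by
  fun_prop

lemma oscillation_comm {f : Plane → ℝ} (hf : Measurable f) (A B : Set Plane) :
    oscillation f A B = oscillation f B A := by
  unfold oscillation
  rw [lintegral_lintegral_swap (measurable_oscillation_integrand hf).aemeasurable]
  simp_rw [sub_sq_comm (f _) (f _)]

lemma oscillation_mono (f : Plane → ℝ) {A A' B B' : Set Plane} (hA : A ⊆ A') (hB : B ⊆ B') :
    oscillation f A B ≤ oscillation f A' B' :=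
  (lintegral_mono_set hA).trans (lintegral_mono fun _ => lintegral_mono_set hB)

lemma oscillation_triangle {f : Plane → ℝ} (hf : Measurable f) (A B C : Set Plane) :
    volume B * oscillation f A C ≤
      2 * (volume C * oscillation f A B) + 2 * (volume A * oscillation f B C) := by
  have hm := measurable_oscillation_integrand hf
  have key : ∀ z w y : Plane, ENNReal.ofReal ((f z - f w) ^ 2) ≤
      2 * ENNReal.ofReal ((f z - f y) ^ 2) + 2 * ENNReal.ofReal ((f y - f w) ^ 2) := by
    intro z w y
    rw [show (2 : ℝ≥0∞) = ENNReal.ofReal 2 by simp, ← ENNReal.ofReal_mul (by norm_num),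
      ← ENNReal.ofReal_mul (by norm_num), ← ENNReal.ofReal_add (by positivity) (by positivity)]
    apply ENNReal.ofReal_le_ofReal
    nlinarith [sq_nonneg (f z - 2 * f y + f w)]
  have m1 : ∀ z, Measurable fun w => ENNReal.ofReal ((f z - f w) ^ 2) := fun z => by fun_prop
  have m2 : ∀ w, Measurable fun z => ENNReal.ofReal ((f z - f w) ^ 2) := fun z => by fun_prop
  calc volume B * oscillation f A C
      = ∫⁻ z in A, ∫⁻ w in C, ∫⁻ _ in B, ENNReal.ofReal ((f z - f w) ^ 2) := by
        unfold oscillation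
        simp_rw [setLIntegral_const]
        rw [mul_comm, ← lintegral_mul_const]
        · refine lintegral_congr fun z => ?_
          rw [lintegral_mul_const _ (m1 z)]
        · exact hm.lintegral_prod_right'
    _ ≤ ∫⁻ z in A, ∫⁻ w in C, ∫⁻ y in B, (2 * ENNReal.ofReal ((f z - f y) ^ 2) +
          2 * ENNReal.ofReal ((f y - f w) ^ 2)) :=
        lintegral_mono fun z => lintegral_mono fun w => lintegral_mono fun y => key z w y
    _ = ∫⁻ z in A, ∫⁻ w in C, (2 * (∫⁻ y in B, ENNReal.ofReal ((f z - f y) ^ 2)) +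
          2 * (∫⁻ y in B, ENNReal.ofReal ((f y - f w) ^ 2))) := by
        refine lintegral_congr fun z => lintegral_congr fun w => ?_
        rw [lintegral_add_left ((m1 z).const_mul 2), lintegral_const_mul _ (m1 z),
          lintegral_const_mul _ (m2 w)]
    _ = ∫⁻ z in A, (2 * (volume C * ∫⁻ y in B, ENNReal.ofReal ((f z - f y) ^ 2)) +
          2 * oscillation f C B) := by
        refine lintegral_congr fun z => ?_
        rw [lintegral_add_left measurable_const, setLIntegral_const, lintegral_const_mul]
        · rw [oscillation]
          simp_rw [sub_sq_comm (f _) (f _)]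
          ring_nf
        · exact (measurable_oscillation_integrand hf).lintegral_prod_left'
    _ = 2 * (volume C * oscillation f A B) + 2 * (volume A * oscillation f B C) := by
        rw [lintegral_add_right _ measurable_const, setLIntegral_const, lintegral_const_mul,
          lintegral_const_mul, oscillation_comm hf C B]
        · rw [oscillation, oscillation]; ring
        · exact hm.lintegral_prod_right'
        · exact (hm.lintegral_prod_right').const_mul _

section Control

variable {𝓕 : Set ((Plane → ℝ) × ℝ≥0∞)} {A B C : Set Plane}

lemma OscControlled.symm (h𝓕 : ∀ F ∈ 𝓕, Measurable F.1) (h : OscControlled 𝓕 A B) :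
    OscControlled 𝓕 B A := by
  obtain ⟨c, hc, H⟩ := h
  exact ⟨c, hc, fun F hF => by rw [oscillation_comm (h𝓕 F hF)]; exact H F hF⟩

lemma OscControlled.mono {A' B' : Set Plane} (h : OscControlled 𝓕 A B) (hA : A' ⊆ A)
    (hB : B' ⊆ B) : OscControlled 𝓕 A' B' := by
  obtain ⟨c, hc, H⟩ := h
  exact ⟨c, hc, fun F hF => (oscillation_mono _ hA hB).trans (H F hF)⟩

lemma OscControlled.trans (h𝓕 : ∀ F ∈ 𝓕, Measurable F.1) (hA : volume A ≠ ⊤)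
    (hB₀ : volume B ≠ 0) (hB : volume B ≠ ⊤) (hC : volume C ≠ ⊤) (h₁ : OscControlled 𝓕 A B)
    (h₂ : OscControlled 𝓕 B C) : OscControlled 𝓕 A C := by
  obtain ⟨c, hc, H⟩ := h₁
  obtain ⟨d, hd, K⟩ := h₂
  refine ⟨(volume B)⁻¹ * (2 * (volume C * c) + 2 * (volume A * d)), ?_, fun F hF => ?_⟩
  · finiteness
  · have h := oscillation_triangle (h𝓕 F hF) A B C
    have h' : volume B * oscillation F.1 A C ≤ (2 * (volume C * c) + 2 * (volume A * d)) * F.2 := by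
      refine h.trans ?_
      calc _ ≤ 2 * (volume C * (c * F.2)) + 2 * (volume A * (d * F.2)) := by
            gcongr
            · exact H F hF
            · exact K F hF
        _ = _ := by ring
    calc oscillation F.1 A C = (volume B)⁻¹ * (volume B * oscillation F.1 A C) := by
          rw [← mul_assoc, ENNReal.inv_mul_cancel hB₀ hB, one_mul]
      _ ≤ (volume B)⁻¹ * ((2 * (volume C * c) + 2 * (volume A * d)) * F.2) := by gcongr
      _ = _ := by ring

lemma OscControlled.union_left (h₁ : OscControlled 𝓕 A C) (h₂ : OscControlled 𝓕 B C) :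
    OscControlled 𝓕 (A ∪ B) C := by
  obtain ⟨c, hc, H⟩ := h₁
  obtain ⟨d, hd, K⟩ := h₂
  refine ⟨c + d, by finiteness, fun F hF => ?_⟩
  rw [add_mul]
  exact (lintegral_union_le _ _ _).trans (add_le_add (H F hF) (K F hF))

lemma OscControlled.of_null (h : volume A = 0) : OscControlled 𝓕 A C := by
  refine ⟨0, by simp, fun F _ => ?_⟩
  rw [oscillation, Measure.restrict_eq_zero.2 h]
  simp

lemma OscControlled.biUnion_left {ι : Type*} {s : Set ι} (hs : s.Finite) {S : ι → Set Plane}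
    (H : ∀ i ∈ s, OscControlled 𝓕 (S i) C) : OscControlled 𝓕 (⋃ i ∈ s, S i) C := by
  induction s, hs using Set.Finite.induction_on with
  | empty => simpa using OscControlled.of_null (by simp)
  | insert _ _ ih =>
    rw [biUnion_insert]
    exact (H _ (by simp)).union_left (ih fun i hi => H i (by simp [hi]))

end Control

/-- If the oscillation over each parallelogram contained in a connected open set `Ω` is controlled,
then so is the oscillation over `Ω`: neighbouring points of `Ω` have overlapping squares, so
connectedness relates any two parallelograms, and finitely many of them cover almost all of `Ω`. -/
lemma OscControlled.of_parallelograms {𝓕 : Set ((Plane → ℝ) × ℝ≥0∞)}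
    (h𝓕 : ∀ F ∈ 𝓕, Measurable F.1) {Ω : Set Plane} (hΩ : IsOpen Ω) (hc : IsPreconnected Ω)
    (hb : Bornology.IsBounded Ω) (hcov : IsParallelogramUnion Ω)
    (hP : ∀ o a b : Plane, cross a b ≠ 0 → openParallelogram o a b ⊆ Ω →
      OscControlled 𝓕 (openParallelogram o a b) (openParallelogram o a b)) :
    OscControlled 𝓕 Ω Ω := by
  have hfin : ∀ S ⊆ Ω, volume S ≠ ⊤ := fun S hS =>
    ((measure_mono hS).trans_lt hb.measure_lt_top).ne
  -- two overlapping open sets with controlled oscillation are mutually controlled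
  have overlap : ∀ P Q : Set Plane, P ⊆ Ω → Q ⊆ Ω → IsOpen P → IsOpen Q → (P ∩ Q).Nonempty →
      OscControlled 𝓕 P P → OscControlled 𝓕 Q Q → OscControlled 𝓕 P Q := by
    intro P Q hPΩ hQΩ hPo hQo hne h₁ h₂
    exact (h₁.mono subset_rfl inter_subset_left).trans h𝓕 (hfin _ hPΩ)
      (((hPo.inter hQo).measure_pos _ hne).ne') (hfin _ (inter_subset_left.trans hPΩ)) (hfin _ hQΩ)
      (h₂.mono inter_subset_right subset_rfl)
  have hsq : ∀ x : Plane, ∃ Q : Set Plane, x ∈ Ω →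
      x ∈ Q ∧ Q ⊆ Ω ∧ IsOpen Q ∧ OscControlled 𝓕 Q Q := by
    intro x
    by_cases hx : x ∈ Ω
    · obtain ⟨ε, hε, hball⟩ := Metric.isOpen_iff.1 hΩ x hx
      have hcr : cross (!₂[ε, 0] : Plane) !₂[0, ε] ≠ 0 := by simp [cross, hε.ne']
      have hsub : openParallelogram (x - !₂[ε / 2, ε / 2]) !₂[ε, 0] !₂[0, ε] ⊆ Ω := by
        rintro z ⟨s, t, hs, hs', ht, ht', rfl⟩
        apply hball
        rw [Metric.mem_ball, EuclideanSpace.dist_eq, Real.sqrt_lt' hε]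
        simp [Real.dist_eq]
        have h1 : (-(ε / 2) + s * ε) ^ 2 < (ε / 2) ^ 2 := by
          apply sq_lt_sq'
          · nlinarith
          · nlinarith
        have h2 : (-(ε / 2) + t * ε) ^ 2 < (ε / 2) ^ 2 := by
          apply sq_lt_sq'
          · nlinarith
          · nlinarith
        nlinarith
      refine ⟨_, fun _ => ⟨?_, hsub, isOpen_openParallelogram hcr, hP _ _ _ hcr hsub⟩⟩
      refine ⟨1 / 2, 1 / 2, by norm_num, by norm_num, by norm_num, by norm_num, ?_⟩
      ext i
      fin_cases i <;> simp <;> ring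
    · exact ⟨∅, fun h => absurd h hx⟩
  choose Q hQ using hsq
  have hconn : ∀ x ∈ Ω, ∀ y ∈ Ω, OscControlled 𝓕 (Q x) (Q y) := by
    intro x hx y hy
    refine hc.induction₂' (fun x y => x ∈ Ω → y ∈ Ω → OscControlled 𝓕 (Q x) (Q y)) ?_ ?_ hx hy hx hy
    · intro x hx
      filter_upwards [mem_nhdsWithin_of_mem_nhds ((hQ x hx).2.2.1.mem_nhds (hQ x hx).1)] with y hy
      have : ∀ _ : x ∈ Ω, ∀ _ : y ∈ Ω, OscControlled 𝓕 (Q x) (Q y) := fun hx hyΩ =>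
        overlap _ _ (hQ x hx).2.1 (hQ y hyΩ).2.1 (hQ x hx).2.2.1 (hQ y hyΩ).2.2.1
          ⟨y, hy, (hQ y hyΩ).1⟩ (hQ x hx).2.2.2 (hQ y hyΩ).2.2.2
      exact ⟨this, fun hy hx => (this hx hy).symm h𝓕⟩
    · intro x y z hx hy hz h₁ h₂ _ _
      exact (h₁ hx hy).trans h𝓕 (hfin _ (hQ x hx).2.1)
        ((hQ y hy).2.2.1.measure_pos _ ⟨y, (hQ y hy).1⟩).ne' (hfin _ (hQ y hy).2.1)
        (hfin _ (hQ z hz).2.1) (h₂ hy hz)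
  obtain ⟨F, hF, hFΩ, hnull⟩ := hcov
  have hPP : ∀ t ∈ F, ∀ t' ∈ F, OscControlled 𝓕 (openParallelogram t.1 t.2.1 t.2.2)
      (openParallelogram t'.1 t'.2.1 t'.2.2) := by
    have hmid : ∀ t ∈ F, (openParallelogram t.1 t.2.1 t.2.2).Nonempty := fun t ht =>
      ⟨_, 1 / 2, 1 / 2, by norm_num, by norm_num, by norm_num, by norm_num, rfl⟩
    have hPQ : ∀ t ∈ F, ∃ x ∈ Ω, OscControlled 𝓕 (openParallelogram t.1 t.2.1 t.2.2) (Q x) := by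
      intro t ht
      obtain ⟨x, hx⟩ := hmid t ht
      have hxΩ := (hFΩ t ht).2 hx
      exact ⟨x, hxΩ, overlap _ _ (hFΩ t ht).2 (hQ x hxΩ).2.1
        (isOpen_openParallelogram (hFΩ t ht).1) (hQ x hxΩ).2.2.1 ⟨x, hx, (hQ x hxΩ).1⟩
        (hP _ _ _ (hFΩ t ht).1 (hFΩ t ht).2) (hQ x hxΩ).2.2.2⟩
    intro t ht t' ht'
    obtain ⟨x, hx, h₁⟩ := hPQ t ht
    obtain ⟨y, hy, h₂⟩ := hPQ t' ht'
    have pos : ∀ x ∈ Ω, volume (Q x) ≠ 0 := fun x hx =>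
      ((hQ x hx).2.2.1.measure_pos _ ⟨x, (hQ x hx).1⟩).ne'
    have h₃ := h₁.trans h𝓕 (hfin _ (hFΩ t ht).2) (pos x hx) (hfin _ (hQ x hx).2.1)
      (hfin _ (hQ y hy).2.1) (hconn x hx y hy)
    exact h₃.trans h𝓕 (hfin _ (hFΩ t ht).2) (pos y hy) (hfin _ (hQ y hy).2.1)
      (hfin _ (hFΩ t' ht').2) (h₂.symm h𝓕)
  -- the parallelograms cover `Ω` up to a null set
  have hcover : ∀ B : Set Plane, (∀ t ∈ F, OscControlled 𝓕 (openParallelogram t.1 t.2.1 t.2.2) B) →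
      OscControlled 𝓕 Ω B := by
    intro B hB
    refine ((OscControlled.biUnion_left hF hB).union_left (OscControlled.of_null hnull)).mono ?_
      subset_rfl
    intro z hz
    rw [union_sdiff_self]
    exact Or.inr hz
  exact hcover _ fun t ht => (hcover _ fun t' ht' => hPP t' ht' t ht).symm h𝓕

/-! ### Piecewise constant functions on a mesh along lines -/

lemma measurableSet_openSegment {a b : Plane} (h : a ≠ b) : MeasurableSet (openSegment ℝ a b) := by
  have : openSegment ℝ a b = segment ℝ a b \ {a, b} := by
    rw [← insert_endpoints_openSegment]
    ext z
    simp only [Set.mem_sdiff, mem_insert_iff, mem_singleton_iff]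
    constructor
    · intro hz
      refine ⟨Or.inr (Or.inr hz), ?_⟩
      rintro (rfl | rfl)
      · exact h (left_mem_openSegment_iff.1 hz)
      · exact h (right_mem_openSegment_iff.1 hz)
    · tauto
  rw [this]
  refine MeasurableSet.diff ?_ (by measurability)
  rw [← closure_openSegment]
  exact isClosed_closure.measurableSet

lemma exists_mem_cross_ne_zero {U : Set Plane} (hU : IsOpen U) (hne : U.Nonempty) {n : Plane}
    (hn : n ≠ 0) (x : Plane) : ∃ w ∈ U, cross n (w - x) ≠ 0 := by
  by_contra! h
  exact (hU.measure_pos volume hne).ne' (measure_mono_null (fun w hw => h w hw) (volume_line hn x))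

lemma convex_halfPlane (n x : Plane) : Convex ℝ {w | 0 < cross n (w - x)} := by
  intro v hv w hw p q hp hq hpq
  have := cross_sub_barycenter n x v w 0 (p := p) (q := q) (r := 0) (by linarith)
  simp only [zero_smul, add_zero, zero_mul] at this
  rw [mem_ofPred_eq, this]
  rcases hp.eq_or_lt with rfl | hp
  · obtain rfl : q = 1 := by linarith
    simpa using hw
  · exact add_pos_of_pos_of_nonneg (mul_pos hp hv) (mul_nonneg hq (le_of_lt hw))

namespace PolygonalMesh

variable {Ω : Set Plane} {T Eint Eext : Type} (M : PolygonalMesh Ω T Eint Eext)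

lemma closure_inner_subset_frontier_left (σ : Eint) :
    closure (M.inner σ) ⊆ frontier (M.cell (M.left σ)) := by
  intro z hz
  rw [M.frontier_cell]
  exact Or.inl (mem_biUnion (show σ ∈ {τ | M.left τ = M.left σ ∨ M.right τ = M.left σ} from Or.inl rfl) hz)

lemma closure_inner_subset_frontier_right (σ : Eint) :
    closure (M.inner σ) ⊆ frontier (M.cell (M.right σ)) := by
  intro z hz
  rw [M.frontier_cell]
  exact Or.inl (mem_biUnion (show σ ∈ {τ | M.left τ = M.right σ ∨ M.right τ = M.right σ} from Or.inr rfl) hz)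

lemma disjoint_closure_cell {K L : T} (h : K ≠ L) : Disjoint (closure (M.cell K)) (M.cell L) :=
  (M.cell_disjoint h).closure_left (M.isOpen_cell L)

lemma disjoint_inner_cell (σ : Eint) (K : T) : Disjoint (M.inner σ) (M.cell K) := by
  rw [disjoint_left]
  intro z hz hK
  have hf := M.closure_inner_subset_frontier_left σ (subset_closure hz)
  by_cases h : M.left σ = K
  · rw [(M.isOpen_cell _).frontier_eq, h] at hf
    exact hf.2 hK
  · exact disjoint_left.1 (M.disjoint_closure_cell h) (frontier_subset_closure hf) hK

/-- The endpoints of the interior edges. -/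
def vertices : Set Plane := {z | ∃ σ, z ∈ closure (M.inner σ) \ M.inner σ}

lemma finite_vertices [Finite Eint] : M.vertices.Finite := by
  have : M.vertices = ⋃ σ, (closure (M.inner σ) \ M.inner σ) := by
    ext z; simp [vertices]
  rw [this]
  refine finite_iUnion fun σ => ?_
  obtain ⟨a, b, -, h⟩ := M.isEdge_inner σ
  refine (toFinite {a, b}).subset ?_
  rw [h, closure_openSegment, ← insert_endpoints_openSegment]
  rintro z ⟨hz, hn⟩
  simp only [mem_insert_iff, mem_singleton_iff] at hz ⊢
  tauto

lemma endpoints_mem_vertices {σ : Eint} {a b : Plane} (hab : a ≠ b)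
    (h : M.inner σ = openSegment ℝ a b) : a ∈ M.vertices ∧ b ∈ M.vertices := by
  refine ⟨⟨σ, ?_⟩, ⟨σ, ?_⟩⟩ <;> rw [h, closure_openSegment]
  · exact ⟨left_mem_segment _ _ _, fun hh => hab (left_mem_openSegment_iff.1 hh)⟩
  · exact ⟨right_mem_segment _ _ _, fun hh => hab (right_mem_openSegment_iff.1 hh)⟩

lemma mem_closure_inner_of_mem_frontier (hΩ : IsOpen Ω) {K : T} {z : Plane} (hz : z ∈ Ω)
    (hf : z ∈ frontier (M.cell K)) : ∃ σ, z ∈ closure (M.inner σ) := by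
  rw [M.frontier_cell] at hf
  rcases hf with hf | hf
  · simp only [mem_iUnion] at hf
    obtain ⟨σ, -, h⟩ := hf
    exact ⟨σ, h⟩
  · simp only [mem_iUnion] at hf
    obtain ⟨σ, -, h⟩ := hf
    have := closure_minimal (M.outer_subset σ) isClosed_frontier h
    rw [hΩ.frontier_eq] at this
    exact absurd hz this.2

lemma exists_mem_closure_cell [Finite T] {z : Plane} (hz : z ∈ Ω) :
    ∃ K, z ∈ closure (M.cell K) := by
  have : z ∈ closure (⋃ K, M.cell K) := by
    rw [M.closure_iUnion_cell]; exact subset_closure hz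
  rw [closure_iUnion_of_finite] at this
  simpa using this

/-- A point of `Ω` which is not a vertex lies in a control volume or on an interior edge. -/
lemma mem_cell_or_mem_inner [Finite T] (hΩ : IsOpen Ω) {z : Plane} (hz : z ∈ Ω)
    (hv : z ∉ M.vertices) : (∃ K, z ∈ M.cell K) ∨ ∃ σ, z ∈ M.inner σ := by
  obtain ⟨K, hK⟩ := M.exists_mem_closure_cell hz
  by_cases hzK : z ∈ M.cell K
  · exact Or.inl ⟨K, hzK⟩
  · obtain ⟨σ, hσ⟩ := M.mem_closure_inner_of_mem_frontier hΩ hz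
      (by rw [(M.isOpen_cell K).frontier_eq]; exact ⟨hK, hzK⟩)
    by_contra hcon
    push Not at hcon
    exact hv ⟨σ, hσ, hcon.2 σ⟩

/-- An open connected part of `Ω` which avoids the boundaries of the control volumes lies in a
single one of them. -/
lemma subset_cell_of_disjoint_frontier [Finite T] {H : Set Plane} (hc : IsPreconnected H)
    (ho : IsOpen H) (hne : H.Nonempty) (hΩ : H ⊆ Ω)
    (hf : ∀ K, Disjoint H (frontier (M.cell K))) : ∃ K, H ⊆ M.cell K := by
  obtain ⟨z, hz⟩ := hne
  obtain ⟨K, hK⟩ := M.exists_mem_closure_cell (hΩ hz)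
  obtain ⟨w, hw, hwK⟩ := mem_closure_iff.1 hK H ho hz
  refine ⟨K, hc.subset_of_closure_inter_subset (M.isOpen_cell K) ⟨w, hw, hwK⟩ ?_⟩
  rintro x ⟨hx, hxH⟩
  by_contra hxK
  exact disjoint_left.1 (hf K) hxH (by rw [(M.isOpen_cell K).frontier_eq]; exact ⟨hx, hxK⟩)

/-- Near a point of an interior edge which is not a vertex, the two sides of the edge lie in the two
control volumes separated by this edge. -/
lemma exists_sides [Finite T] [Finite Eint] (hΩ : IsOpen Ω) {σ : Eint} {a b : Plane} (hab : a ≠ b)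
    (hσ : M.inner σ = openSegment ℝ a b) {z : Plane} (hz : z ∈ M.inner σ) (hv : z ∉ M.vertices) :
    ∃ K L, ((K = M.left σ ∧ L = M.right σ) ∨ (K = M.right σ ∧ L = M.left σ)) ∧
      ∀ᶠ w in 𝓝 z, (0 < cross (b - a) (w - a) → w ∈ M.cell K) ∧
        (cross (b - a) (w - a) < 0 → w ∈ M.cell L) := by
  have hn : b - a ≠ 0 := sub_ne_zero.2 hab.symm
  have hz0 : cross (b - a) (z - a) = 0 := by
    rw [hσ] at hz
    exact segment_subset_line a b (openSegment_subset_segment _ _ _ hz)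
  set F : Set Plane := (⋃ τ ∈ {τ | τ ≠ σ}, closure (M.inner τ)) ∪ Ωᶜ with hF
  have hFc : IsClosed F :=
    ((toFinite _).isClosed_biUnion fun _ _ => isClosed_closure).union hΩ.isClosed_compl
  have hzF : z ∉ F := by
    rintro (h | h)
    · simp only [mem_iUnion] at h
      obtain ⟨τ, hτ, hzτ⟩ := h
      by_cases hzτ' : z ∈ M.inner τ
      · exact disjoint_left.1 (M.inner_disjoint hτ) hzτ' hz
      · exact hv ⟨τ, hzτ, hzτ'⟩
    · exact h (M.inner_subset σ hz)
  obtain ⟨ε, hε, hball⟩ := Metric.isOpen_iff.1 hFc.isOpen_compl z hzF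
  have hfr : ∀ w ∈ Metric.ball z ε, cross (b - a) (w - a) ≠ 0 → ∀ K, w ∉ frontier (M.cell K) := by
    intro w hw hw0 K hK
    have hwΩ : w ∈ Ω := by
      by_contra h
      exact hball hw (Or.inr h)
    obtain ⟨τ, hτ⟩ := M.mem_closure_inner_of_mem_frontier hΩ hwΩ hK
    by_cases h : τ = σ
    · rw [h, hσ, closure_openSegment] at hτ
      exact hw0 (segment_subset_line a b hτ)
    · exact hball hw (Or.inl (mem_biUnion (x := τ) h hτ))
  -- each half ball lies in a single control volume
  have half : ∀ m : Plane, (∀ w, cross m (w - a) ≠ 0 → cross (b - a) (w - a) ≠ 0) →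
      (∃ w ∈ Metric.ball z ε, 0 < cross m (w - a)) →
      ∃ K, ∀ w ∈ Metric.ball z ε, 0 < cross m (w - a) → w ∈ M.cell K := by
    rintro m hm ⟨w₀, hw₀, hw₀'⟩
    have ho : IsOpen {w | 0 < cross m (w - a)} :=
      isOpen_lt continuous_const ((continuous_cross_left m).comp (continuous_id.sub continuous_const))
    obtain ⟨K, hK⟩ := M.subset_cell_of_disjoint_frontier
      (H := Metric.ball z ε ∩ {w | 0 < cross m (w - a)})
      ((convex_ball z ε).inter (convex_halfPlane m a)).isPreconnected
      (Metric.isOpen_ball.inter ho) ⟨w₀, hw₀, hw₀'⟩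
      (fun w hw => by
        by_contra h
        exact hball hw.1 (Or.inr h))
      (fun K => disjoint_left.2 fun w hw => hfr w hw.1 (hm w (ne_of_gt hw.2)) K)
    exact ⟨K, fun w hw hw' => hK ⟨hw, hw'⟩⟩
  have hneg : ∀ w : Plane, cross (-(b - a)) (w - a) = - cross (b - a) (w - a) := by
    intro w; simp only [cross, PiLp.neg_apply]; ring
  -- the ball meets both sides, by symmetry with respect to `z`
  have hboth : (∃ w ∈ Metric.ball z ε, 0 < cross (b - a) (w - a)) ∧
      ∃ w ∈ Metric.ball z ε, 0 < cross (-(b - a)) (w - a) := by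
    obtain ⟨w, hw, hw0⟩ := exists_mem_cross_ne_zero Metric.isOpen_ball
      ⟨z, Metric.mem_ball_self hε⟩ hn a
    have hr : z + (z - w) ∈ Metric.ball z ε := by
      rw [Metric.mem_ball, dist_eq_norm] at hw ⊢
      rwa [add_sub_cancel_left, norm_sub_rev]
    have hr' : cross (b - a) (z + (z - w) - a) = - cross (b - a) (w - a) := by
      simp only [cross, PiLp.sub_apply, PiLp.add_apply] at hz0 ⊢
      linear_combination 2 * hz0
    rcases lt_or_gt_of_ne hw0 with h | h
    · exact ⟨⟨_, hr, by rw [hr']; linarith⟩, ⟨w, hw, by rw [hneg]; linarith⟩⟩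
    · exact ⟨⟨w, hw, h⟩, ⟨_, hr, by rw [hneg, hr']; linarith⟩⟩
  obtain ⟨K, hK⟩ := half (b - a) (fun _ h => h) hboth.1
  obtain ⟨L, hL⟩ := half (-(b - a)) (fun w h => by rw [hneg] at h; exact neg_ne_zero.1 h) hboth.2
  -- a control volume having `z` on its boundary is one of these two
  have hmeet : ∀ N, z ∈ frontier (M.cell N) → N = K ∨ N = L := by
    intro N hN
    obtain ⟨w₁, hw₁⟩ := mem_closure_iff.1 (frontier_subset_closure hN) _ Metric.isOpen_ball
      (Metric.mem_ball_self hε)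
    obtain ⟨w, ⟨hw, hwN⟩, hw0⟩ := exists_mem_cross_ne_zero
      (Metric.isOpen_ball.inter (M.isOpen_cell N)) ⟨w₁, hw₁⟩ hn a
    rcases lt_or_gt_of_ne hw0 with h | h
    · right
      by_contra hne
      exact disjoint_left.1 (M.cell_disjoint hne) hwN (hL w hw (by rw [hneg]; linarith))
    · left
      by_contra hne
      exact disjoint_left.1 (M.cell_disjoint hne) hwN (hK w hw h)
  have h1 := hmeet _ (M.closure_inner_subset_frontier_left σ (subset_closure hz))
  have h2 := hmeet _ (M.closure_inner_subset_frontier_right σ (subset_closure hz))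
  have h3 := M.left_ne_right σ
  refine ⟨K, L, ?_, ?_⟩
  · rcases h1 with h1 | h1 <;> rcases h2 with h2 | h2
    · exact absurd (h1.trans h2.symm) h3
    · exact Or.inl ⟨h1.symm, h2.symm⟩
    · exact Or.inr ⟨h2.symm, h1.symm⟩
    · exact absurd (h1.trans h2.symm) h3
  · filter_upwards [Metric.ball_mem_nhds z hε] with w hw
    exact ⟨hK w hw, fun h => hL w hw (by rw [hneg]; linarith)⟩

section Value

variable [Fintype T] [Fintype Eint]

/-- The piecewise constant function equal to `u K` on the control volume `K`. On an interior edge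
it takes one of the two adjacent values, so that its restriction to a line has no other jumps
than those between neighbouring control volumes. -/
noncomputable def value (u : T → ℝ) (z : Plane) : ℝ :=
  ∑ K, (M.cell K).indicator (fun _ => u K) z +
    ∑ σ, (M.inner σ).indicator (fun _ => u (M.left σ)) z

lemma measurable_value (u : T → ℝ) : Measurable (M.value u) := by
  unfold value
  refine (Finset.measurable_sum _ fun K _ => ?_).add (Finset.measurable_sum _ fun σ _ => ?_)
  · exact measurable_const.indicator (M.isOpen_cell K).measurableSet
  · obtain ⟨a, b, hab, h⟩ := M.isEdge_inner σ
    rw [h]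
    exact measurable_const.indicator (measurableSet_openSegment hab)

lemma value_of_mem_cell (u : T → ℝ) {K : T} {z : Plane} (hz : z ∈ M.cell K) :
    M.value u z = u K := by
  classical
  unfold value
  rw [Finset.sum_eq_single K, Finset.sum_eq_zero, indicator_of_mem hz, add_zero]
  · intro σ _
    exact indicator_of_notMem (fun h => disjoint_left.1 (M.disjoint_inner_cell σ K) h hz) _
  · intro L _ hL
    exact indicator_of_notMem (fun h => disjoint_left.1 (M.cell_disjoint hL) h hz) _
  · simp

lemma value_of_mem_inner (u : T → ℝ) {σ : Eint} {z : Plane} (hz : z ∈ M.inner σ) :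
    M.value u z = u (M.left σ) := by
  classical
  unfold value
  rw [Finset.sum_eq_zero, Finset.sum_eq_single σ, indicator_of_mem hz, zero_add]
  · intro τ _ hτ
    exact indicator_of_notMem (fun h => disjoint_left.1 (M.inner_disjoint hτ) h hz) _
  · simp
  · intro K _
    exact indicator_of_notMem (fun h => disjoint_left.1 (M.disjoint_inner_cell σ K) hz h) _

open scoped Classical in
/-- Along a line avoiding the vertices, the jump across the edge `σ` is carried by a function which
is locally constant away from `σ`. -/
lemma exists_jump_function (hΩ : IsOpen Ω) (u : T → ℝ) {z₀ d : Plane} (hd : d ≠ 0)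
    (hv : ∀ r : ℝ, z₀ + r • d ∉ M.vertices) (σ : Eint) :
    ∃ ρ : ℝ → ℝ, (∀ x y, |ρ x - ρ y| ≤
        if ∃ r : ℝ, z₀ + r • d ∈ M.inner σ then |u (M.left σ) - u (M.right σ)| else 0) ∧
      (∀ x : ℝ, z₀ + x • d ∉ M.inner σ → ∀ᶠ y in 𝓝 x, ρ y = ρ x) ∧
      ∀ x : ℝ, z₀ + x • d ∈ M.inner σ → ∀ᶠ y in 𝓝 x,
        M.value u (z₀ + y • d) - ρ y = M.value u (z₀ + x • d) - ρ x := by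
  by_cases hit : ∃ r : ℝ, z₀ + r • d ∈ M.inner σ
  swap
  · refine ⟨fun _ => 0, fun _ _ => by simp [hit], by simp, fun x hx => absurd ⟨x, hx⟩ hit⟩
  obtain ⟨r₀, hr₀⟩ := hit
  obtain ⟨a, b, hab, hσ⟩ := M.isEdge_inner σ
  have hline : ∀ w ∈ M.inner σ, cross (b - a) (w - a) = 0 := by
    intro w hw
    rw [hσ] at hw
    exact segment_subset_line a b (openSegment_subset_segment _ _ _ hw)
  -- the line crosses the edge transversally, otherwise it would contain the vertex `a`
  have hc : cross (b - a) d ≠ 0 := by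
    intro h0
    have hn : b - a ≠ 0 := sub_ne_zero.2 hab.symm
    obtain ⟨t, ht⟩ := exists_smul_of_cross_eq_zero hn (hline _ hr₀)
    obtain ⟨s, hs⟩ := exists_smul_of_cross_eq_zero hn h0
    have hs0 : s ≠ 0 := by
      rintro rfl; exact hd (by simpa using hs)
    apply hv (r₀ - t / s)
    have : z₀ + (r₀ - t / s) • d = a := by
      have e : (t / s) • d = t • (b - a) := by
        rw [hs, smul_smul]; field_simp
      rw [sub_smul, e, ← ht]; abel
    rw [this]
    exact (M.endpoints_mem_vertices hab hσ).1
  have hg : ∀ x : ℝ, cross (b - a) (z₀ + x • d - a) = (x - r₀) * cross (b - a) d := by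
    intro x
    have h := hline _ hr₀
    simp only [cross, PiLp.sub_apply, PiLp.add_apply, PiLp.smul_apply, smul_eq_mul] at h ⊢
    linear_combination h
  obtain ⟨K, L, hKL, hside⟩ : ∃ K L,
      ((K = M.left σ ∧ L = M.right σ) ∨ (K = M.right σ ∧ L = M.left σ)) ∧
      ∀ᶠ y in 𝓝 r₀, (r₀ < y → z₀ + y • d ∈ M.cell K) ∧ (y < r₀ → z₀ + y • d ∈ M.cell L) := by
    obtain ⟨K, L, hKL, hside⟩ := M.exists_sides hΩ hab hσ hr₀ (hv r₀)
    have hcont : Tendsto (fun y : ℝ => z₀ + y • d) (𝓝 r₀) (𝓝 (z₀ + r₀ • d)) :=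
      Continuous.tendsto (by fun_prop) r₀
    have hside' := hcont.eventually hside
    rcases lt_or_gt_of_ne hc with h | h
    · refine ⟨L, K, by tauto, ?_⟩
      filter_upwards [hside'] with y hy
      rw [hg] at hy
      exact ⟨fun hr => hy.2 (mul_neg_of_pos_of_neg (by linarith) h),
        fun hr => hy.1 (mul_pos_of_neg_of_neg (by linarith) h)⟩
    · refine ⟨K, L, hKL, ?_⟩
      filter_upwards [hside'] with y hy
      rw [hg] at hy
      exact ⟨fun hr => hy.1 (mul_pos (by linarith) h),
        fun hr => hy.2 (mul_neg_of_neg_of_pos (by linarith) h)⟩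
  refine ⟨fun x => if x < r₀ then u L else if x = r₀ then u (M.left σ) else u K, ?_, ?_, ?_⟩
  · intro x y
    rw [if_pos ⟨r₀, hr₀⟩]
    have h1 := abs_sub_comm (u (M.left σ)) (u (M.right σ))
    rcases hKL with ⟨rfl, rfl⟩ | ⟨rfl, rfl⟩ <;> dsimp only <;> split_ifs <;> simp [h1]
  · intro x hx
    have hx0 : x ≠ r₀ := by rintro rfl; exact hx hr₀
    rcases lt_or_gt_of_ne hx0 with h | h
    · filter_upwards [Iio_mem_nhds h] with y hy
      rw [if_pos (show y < r₀ from hy), if_pos h]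
    · filter_upwards [Ioi_mem_nhds h] with y hy
      have hy : r₀ < y := hy
      rw [if_neg hy.not_gt, if_neg hy.ne', if_neg h.not_gt, if_neg h.ne']
  · intro x hx
    obtain rfl : x = r₀ := by
      have h1 := hg x
      rw [hline _ hx] at h1
      have := (mul_eq_zero.1 h1.symm).resolve_right hc
      linarith
    filter_upwards [hside] with y hy
    rw [M.value_of_mem_inner u hx, if_neg (lt_irrefl x), if_pos rfl, sub_self]
    rcases lt_trichotomy y x with h | h | h
    · rw [if_pos h, M.value_of_mem_cell u (hy.2 h), sub_self]
    · rw [h, if_neg (lt_irrefl x), if_pos rfl, M.value_of_mem_inner u hx, sub_self]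
    · rw [if_neg h.not_gt, if_neg h.ne', M.value_of_mem_cell u (hy.1 h), sub_self]

open scoped Classical in
/-- The variation of a piecewise constant function along a segment of a line avoiding the vertices
is at most the sum of the jumps across the edges met by this line. -/
lemma abs_value_sub_value_le (hΩ : IsOpen Ω) (u : T → ℝ) {z₀ d : Plane} (hd : d ≠ 0)
    (hv : ∀ r : ℝ, z₀ + r • d ∉ M.vertices) {J : Set ℝ} (hJ : IsPreconnected J)
    (hJΩ : ∀ r ∈ J, z₀ + r • d ∈ Ω) {x y : ℝ} (hx : x ∈ J) (hy : y ∈ J) :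
    |M.value u (z₀ + x • d) - M.value u (z₀ + y • d)| ≤
      ∑ σ, if ∃ r : ℝ, z₀ + r • d ∈ M.inner σ then |u (M.left σ) - u (M.right σ)| else 0 := by
  choose ρ hρ₁ hρ₂ hρ₃ using M.exists_jump_function hΩ u hd hv
  have hconst : M.value u (z₀ + x • d) - ∑ σ, ρ σ x = M.value u (z₀ + y • d) - ∑ σ, ρ σ y := by
    refine hJ.induction₂ (fun x y => M.value u (z₀ + x • d) - ∑ σ, ρ σ x =
      M.value u (z₀ + y • d) - ∑ σ, ρ σ y) ?_ (fun _ _ _ _ _ _ h₁ h₂ => h₁.trans h₂)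
      (fun _ _ _ _ h => h.symm) hx hy
    intro r hr
    apply eventually_nhdsWithin_of_eventually_nhds
    rcases M.mem_cell_or_mem_inner hΩ (hJΩ r hr) (hv r) with ⟨K, hK⟩ | ⟨σ, hσ⟩
    · have hρ : ∀ᶠ y in 𝓝 r, ∀ σ, ρ σ y = ρ σ r := eventually_all.2 fun σ =>
        hρ₂ σ r fun h => disjoint_left.1 (M.disjoint_inner_cell σ K) h hK
      have hcont : Tendsto (fun y : ℝ => z₀ + y • d) (𝓝 r) (𝓝 (z₀ + r • d)) :=
        Continuous.tendsto (by fun_prop) r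
      filter_upwards [hρ, hcont.eventually ((M.isOpen_cell K).mem_nhds hK)] with y h₁ h₂
      rw [M.value_of_mem_cell u hK, M.value_of_mem_cell u h₂]
      simp_rw [h₁]
    · have hρ : ∀ᶠ y in 𝓝 r, ∀ τ, τ ≠ σ → ρ τ y = ρ τ r := by
        refine eventually_all.2 fun τ => ?_
        by_cases h : τ = σ
        · exact Eventually.of_forall fun _ h' => absurd h h'
        · filter_upwards [hρ₂ τ r fun h' => disjoint_left.1 (M.inner_disjoint h) h' hσ] with y hy _
            using hy
      filter_upwards [hρ, hρ₃ σ r hσ] with y h₁ h₂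
      rw [← Finset.add_sum_erase _ _ (Finset.mem_univ σ),
        ← Finset.add_sum_erase (a := σ) _ (fun σ => ρ σ y) (Finset.mem_univ σ),
        Finset.sum_congr rfl fun τ hτ => h₁ τ (Finset.ne_of_mem_erase hτ)]
      linarith
  have : M.value u (z₀ + x • d) - M.value u (z₀ + y • d) = ∑ σ, (ρ σ x - ρ σ y) := by
    rw [Finset.sum_sub_distrib]; linarith
  rw [this]
  exact (Finset.abs_sum_le_sum_abs _ _).trans (Finset.sum_le_sum fun σ _ => hρ₁ σ x y)

end Value

end PolygonalMesh

/-! ### The `BV` inequality for piecewise constant functions -/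

lemma abs_cross_le (v w : Plane) : |cross v w| ≤ ‖v‖ * ‖w‖ := by
  apply abs_le_of_sq_le_sq _ (by positivity)
  rw [mul_pow, EuclideanSpace.real_norm_sq_eq, EuclideanSpace.real_norm_sq_eq]
  simp only [cross, Fin.sum_univ_two]
  nlinarith [sq_nonneg (v 0 * w 0 + v 1 * w 1)]

lemma edgeLength_openSegment (a b : Plane) :
    edgeLength (openSegment ℝ a b) = dist a b := by
  have h1 : Measure.hausdorffMeasure 1 (openSegment ℝ a b) =
      Measure.hausdorffMeasure 1 (segment ℝ a b) := by
    rw [← insert_endpoints_openSegment]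
    have : NullSingletonClass (Measure.hausdorffMeasure 1 : Measure Plane) :=
      Measure.nullSingletonClass_hausdorff Plane one_pos
    rw [measure_congr (insert_ae_eq_self _ _), measure_congr (insert_ae_eq_self _ _)]
  rw [edgeLength, h1, hausdorffMeasure_segment, edist_dist, ENNReal.toReal_ofReal dist_nonneg]

lemma edgeLength_nonneg (σ : Set Plane) : 0 ≤ edgeLength σ := ENNReal.toReal_nonneg

/-- Linear coordinates of the plane in the basis `(a, b)`. -/
noncomputable def basisEquiv {a b : Plane} (h : cross a b ≠ 0) : (ℝ × ℝ) ≃L[ℝ] Plane where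
  toFun p := p.1 • a + p.2 • b
  invFun z := (cross z b / cross a b, cross a z / cross a b)
  map_add' p q := by simp only [Prod.fst_add, Prod.snd_add]; module
  map_smul' c p := by simp only [Prod.smul_fst, Prod.smul_snd, smul_eq_mul, RingHom.id_apply]; module
  left_inv p := by
    ext
    · rw [div_eq_iff h]
      simp only [cross, PiLp.add_apply, PiLp.smul_apply, smul_eq_mul]; ring
    · rw [div_eq_iff h]
      simp only [cross, PiLp.add_apply, PiLp.smul_apply, smul_eq_mul]; ring
  right_inv z := (eq_smul_add_smul_of_cross_ne_zero h z).symm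
  continuous_toFun := by fun_prop
  continuous_invFun := by
    simp only [cross]
    fun_prop

/-- Integration over a parallelogram in the coordinates given by its sides. The constant is the
area of the parallelogram, but only its finiteness matters. -/
lemma exists_lintegral_openParallelogram {a b : Plane} (h : cross a b ≠ 0) (o : Plane) :
    ∃ c : ℝ≥0∞, c ≠ ⊤ ∧ ∀ F : Plane → ℝ≥0∞, Measurable F →
      ∫⁻ z in openParallelogram o a b, F z =
        c * ∫⁻ s in Ioo (0 : ℝ) 1, ∫⁻ t in Ioo (0 : ℝ) 1, F (o + s • a + t • b) := by
  set e := basisEquiv h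
  have he : ∀ p : ℝ × ℝ, e p = p.1 • a + p.2 • b := fun _ => rfl
  have := e.isAddHaarMeasure_map (volume : Measure (ℝ × ℝ))
  have hvol := Measure.isAddLeftInvariant_eq_smul (volume : Measure Plane)
    (Measure.map e (volume : Measure (ℝ × ℝ)))
  set c := Measure.addHaarScalarFactor (volume : Measure Plane)
    (Measure.map e (volume : Measure (ℝ × ℝ)))
  refine ⟨c, ENNReal.coe_ne_top, fun F hF => ?_⟩
  have hP := (isOpen_openParallelogram (o := o) h).measurableSet
  have hme : Measurable e := e.continuous.measurable
  have hG : Measurable fun z => (openParallelogram o a b).indicator F (o + z) :=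
    (hF.indicator hP).comp (measurable_const_add o)
  have hmem : ∀ p : ℝ × ℝ, o + e p ∈ openParallelogram o a b ↔ p ∈ Ioo (0 : ℝ) 1 ×ˢ Ioo (0 : ℝ) 1 := by
    intro p
    rw [mem_openParallelogram_iff h, add_sub_cancel_left]
    have : (cross (e p) b / cross a b, cross a (e p) / cross a b) = p := e.left_inv p
    rw [show cross (e p) b / cross a b = p.1 from congrArg Prod.fst this,
      show cross a (e p) / cross a b = p.2 from congrArg Prod.snd this]
    rfl
  calc ∫⁻ z in openParallelogram o a b, F z
      = ∫⁻ z, (openParallelogram o a b).indicator F (o + z) := by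
        rw [lintegral_add_left_eq_self (fun z => (openParallelogram o a b).indicator F z),
          lintegral_indicator hP]
    _ = c * ∫⁻ p, (openParallelogram o a b).indicator F (o + e p) := by
        rw [hvol, lintegral_smul_measure, lintegral_map hG hme, ENNReal.smul_def, smul_eq_mul]
    _ = c * ∫⁻ p in Ioo (0 : ℝ) 1 ×ˢ Ioo (0 : ℝ) 1, F (o + e p) := by
        rw [← lintegral_indicator (measurableSet_Ioo.prod measurableSet_Ioo)]
        congr 1
        refine lintegral_congr fun p => ?_
        by_cases hp : p ∈ Ioo (0 : ℝ) 1 ×ˢ Ioo (0 : ℝ) 1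
        · rw [indicator_of_mem hp, indicator_of_mem ((hmem p).2 hp)]
        · rw [indicator_of_notMem hp, indicator_of_notMem (mt (hmem p).1 hp)]
    _ = _ := by
        rw [Measure.volume_eq_prod, ← Measure.prod_restrict, lintegral_prod]
        · simp_rw [he, add_assoc]
        · exact (hF.comp (hme.const_add o)).aemeasurable

namespace PolygonalMesh

variable {Ω : Set Plane} {T Eint Eext : Type} (M : PolygonalMesh Ω T Eint Eext)

/-- The total variation `∑_{σ = K|L} m_σ |u_K - u_L|` of a piecewise constant function. -/
noncomputable def variation [Fintype Eint] (u : T → ℝ) : ℝ :=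
  ∑ σ, edgeLength (M.inner σ) * |u (M.left σ) - u (M.right σ)|

variable [Fintype T] [Fintype Eint]

/-- On almost every line parallel to the side `a` of a parallelogram, the variation of a piecewise
constant function is bounded by a function whose integral over all these lines is at most the total
variation, up to a constant. -/
lemma exists_slice_bound (hΩ : IsOpen Ω) (u : T → ℝ) {o a b : Plane} (h : cross a b ≠ 0)
    (hP : openParallelogram o a b ⊆ Ω) :
    ∃ W : ℝ → ℝ≥0∞, Measurable W ∧
      ∫⁻ t in Ioo (0 : ℝ) 1, W t ≤ ENNReal.ofReal (‖a‖ / |cross a b|) *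
        ENNReal.ofReal (M.variation u) ∧
      ∀ᵐ t ∂volume.restrict (Ioo (0 : ℝ) 1), ∀ r ∈ Ioo (0 : ℝ) 1, ∀ r' ∈ Ioo (0 : ℝ) 1,
        ENNReal.ofReal |M.value u (o + r • a + t • b) - M.value u (o + r' • a + t • b)| ≤ W t := by
  classical
  choose p q hpq hσ using M.isEdge_inner
  -- the coordinate of `z` transversal to `a`
  let τ : Plane → ℝ := fun z => cross a (z - o) / cross a b
  let J : Eint → ℝ := fun σ => |u (M.left σ) - u (M.right σ)|
  have hJ : ∀ σ, 0 ≤ J σ := fun σ => abs_nonneg _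
  have hτ : ∀ r t : ℝ, τ (o + t • b + r • a) = t := by
    intro r t
    simp only [τ]
    rw [div_eq_iff h]
    simp only [cross, PiLp.sub_apply, PiLp.add_apply, PiLp.smul_apply, smul_eq_mul]; ring
  refine ⟨fun t => ∑ σ, (uIcc (τ (p σ)) (τ (q σ))).indicator (fun _ => ENNReal.ofReal (J σ)) t,
    ?_, ?_, ?_⟩
  · exact Finset.measurable_sum _ fun σ _ => measurable_const.indicator measurableSet_uIcc
  · rw [lintegral_finsetSum _ fun σ _ => measurable_const.indicator measurableSet_uIcc, variation,
      ENNReal.ofReal_sum_of_nonneg fun σ _ => mul_nonneg (edgeLength_nonneg _) (hJ σ),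
      Finset.mul_sum]
    refine Finset.sum_le_sum fun σ _ => ?_
    calc ∫⁻ t in Ioo (0 : ℝ) 1,
          (uIcc (τ (p σ)) (τ (q σ))).indicator (fun _ => ENNReal.ofReal (J σ)) t
        ≤ ∫⁻ t, (uIcc (τ (p σ)) (τ (q σ))).indicator (fun _ => ENNReal.ofReal (J σ)) t :=
          setLIntegral_le_lintegral _ _
      _ = ENNReal.ofReal (J σ) * ENNReal.ofReal |τ (q σ) - τ (p σ)| := by
          rw [lintegral_indicator_const measurableSet_uIcc, Real.volume_interval]
      _ ≤ _ := by
          rw [← ENNReal.ofReal_mul (hJ σ), ← ENNReal.ofReal_mul (by positivity)]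
          apply ENNReal.ofReal_le_ofReal
          have e1 : τ (q σ) - τ (p σ) = cross a (q σ - p σ) / cross a b := by
            simp only [τ, ← sub_div]
            congr 1
            simp only [cross, PiLp.sub_apply]; ring
          have e2 : |τ (q σ) - τ (p σ)| ≤ ‖a‖ / |cross a b| * edgeLength (M.inner σ) := by
            rw [e1, abs_div, hσ, edgeLength_openSegment, dist_comm, dist_eq_norm,
              div_mul_eq_mul_div]
            gcongr
            exact abs_cross_le _ _
          calc J σ * |τ (q σ) - τ (p σ)| ≤ J σ * (‖a‖ / |cross a b| * edgeLength (M.inner σ)) := by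
                gcongr
            _ = _ := by ring
  · have hae : ∀ᵐ t ∂(volume : Measure ℝ), t ∉ τ '' M.vertices :=
      (M.finite_vertices.image τ).countable.ae_notMem volume
    filter_upwards [ae_restrict_of_ae hae, ae_restrict_mem measurableSet_Ioo] with t ht ht' r hr r' hr'
    have hv : ∀ r : ℝ, o + t • b + r • a ∉ M.vertices := fun r hr => ht ⟨_, hr, hτ r t⟩
    have hcomm : ∀ r : ℝ, o + r • a + t • b = o + t • b + r • a := fun r => by abel
    have key := M.abs_value_sub_value_le hΩ u (left_ne_zero_of_cross_ne_zero h) hv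
      (isPreconnected_Ioo (a := (0 : ℝ)) (b := 1))
      (fun r hr => hP ⟨r, t, hr.1, hr.2, ht'.1, ht'.2, (hcomm r).symm⟩) hr hr'
    rw [hcomm, hcomm]
    refine (ENNReal.ofReal_le_ofReal key).trans ?_
    rw [ENNReal.ofReal_sum_of_nonneg]
    · refine Finset.sum_le_sum fun σ _ => ?_
      split_ifs with hit
      · obtain ⟨x, hx⟩ := hit
        rw [indicator_of_mem]
        rw [hσ] at hx
        obtain ⟨α, β, hα, hβ, hαβ, hx⟩ := hx
        rw [← segment_eq_uIcc]
        refine ⟨α, β, hα.le, hβ.le, hαβ, ?_⟩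
        rw [← hτ x t, ← hx]
        simp only [τ, smul_eq_mul]
        field_simp
        obtain rfl : α = 1 - β := by linarith
        simp only [cross, PiLp.sub_apply, PiLp.add_apply, PiLp.smul_apply, smul_eq_mul]; ring
      · simp
    · intro σ _
      split_ifs
      · exact hJ σ
      · exact le_rfl

end PolygonalMesh

/-- The piecewise constant functions on the meshes of `Ω`, paired with the square of their total
variation. -/
def meshFamily (Ω : Set Plane) : Set ((Plane → ℝ) × ℝ≥0∞) :=
  {F | ∃ (T Eint Eext : Type) (_ : Fintype T) (_ : Fintype Eint)
    (M : PolygonalMesh Ω T Eint Eext) (u : T → ℝ),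
    F = (M.value u, ENNReal.ofReal (M.variation u) ^ 2)}

/-- The Gagliardo–Nirenberg argument on a parallelogram: with `V₁`, `V₂` the variations along the
lines parallel to the two sides, going from `(s, t)` to `(s', t')` through either of the two other
corners of a coordinate rectangle shows that the squared difference is at most
`(V₁ t + V₂ s') (V₂ s + V₁ t')`. -/
lemma oscControlled_meshFamily_openParallelogram {Ω : Set Plane} (hΩ : IsOpen Ω) {o a b : Plane}
    (h : cross a b ≠ 0) (hP : openParallelogram o a b ⊆ Ω) :
    OscControlled (meshFamily Ω) (openParallelogram o a b) (openParallelogram o a b) := by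
  obtain ⟨c, hc, hint⟩ := exists_lintegral_openParallelogram h o
  have h' : cross b a ≠ 0 := by
    intro h0; apply h; simp only [cross] at h0 ⊢; linarith
  have hP' : openParallelogram o b a ⊆ Ω := by
    rintro z ⟨s, t, hs, hs', ht, ht', rfl⟩
    exact hP ⟨t, s, ht, ht', hs, hs', by abel⟩
  set k₁ := ENNReal.ofReal (‖a‖ / |cross a b|)
  set k₂ := ENNReal.ofReal (‖b‖ / |cross b a|)
  refine ⟨c * c * (k₁ + k₂) ^ 2, by finiteness, ?_⟩
  rintro _ ⟨T, Eint, Eext, _, _, M, u, rfl⟩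
  set f := M.value u
  have hf : Measurable f := M.measurable_value u
  set V := ENNReal.ofReal (M.variation u)
  obtain ⟨W₁, mW₁, iW₁, hW₁⟩ := M.exists_slice_bound hΩ u h hP
  obtain ⟨W₂, mW₂, iW₂, hW₂⟩ := M.exists_slice_bound hΩ u h' hP'
  set I₁ := ∫⁻ t in Ioo (0 : ℝ) 1, W₁ t
  set I₂ := ∫⁻ t in Ioo (0 : ℝ) 1, W₂ t
  set μ : Measure ℝ := volume.restrict (Ioo 0 1)
  have hμ : μ univ = 1 := by simp [μ]
  have m1 : ∀ z, Measurable fun w => ENNReal.ofReal ((f z - f w) ^ 2) := fun z => by fun_prop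
  have hsplit : oscillation f (openParallelogram o a b) (openParallelogram o a b) =
      c * c * ∫⁻ s, ∫⁻ t, ∫⁻ s', ∫⁻ t', ENNReal.ofReal
        ((f (o + s • a + t • b) - f (o + s' • a + t' • b)) ^ 2) ∂μ ∂μ ∂μ ∂μ := by
    have hmq : Measurable fun q : (Plane × ℝ) × ℝ => ENNReal.ofReal
        ((f q.1.1 - f (o + q.1.2 • a + q.2 • b)) ^ 2) := by
      refine ENNReal.measurable_ofReal.comp (Measurable.pow_const (Measurable.sub ?_ ?_) 2)
      · exact hf.comp (Continuous.measurable (by fun_prop))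
      · exact hf.comp (Continuous.measurable (by fun_prop))
    have hG : Measurable fun z => ∫⁻ s', ∫⁻ t', ENNReal.ofReal
        ((f z - f (o + s' • a + t' • b)) ^ 2) ∂μ ∂μ :=
      (hmq.lintegral_prod_right' (ν := μ)).lintegral_prod_right' (ν := μ)
    rw [oscillation, lintegral_congr fun z => hint _ (m1 z), lintegral_const_mul _ hG,
      hint _ hG, mul_assoc]
  change oscillation f _ _ ≤ c * c * (k₁ + k₂) ^ 2 * V ^ 2
  have hbound : ∫⁻ s, ∫⁻ t, ∫⁻ s', ∫⁻ t', ENNReal.ofReal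
        ((f (o + s • a + t • b) - f (o + s' • a + t' • b)) ^ 2) ∂μ ∂μ ∂μ ∂μ ≤
      ∫⁻ s, ∫⁻ t, ∫⁻ s', ∫⁻ t', (W₁ t + W₂ s') * (W₂ s + W₁ t') ∂μ ∂μ ∂μ ∂μ := by
    have hmem : ∀ᵐ t ∂μ, t ∈ Ioo (0 : ℝ) 1 := ae_restrict_mem measurableSet_Ioo
    refine lintegral_mono_ae ?_
    filter_upwards [hmem, hW₂] with s hs hs₂
    refine lintegral_mono_ae ?_
    filter_upwards [hmem, hW₁] with t ht ht₁
    refine lintegral_mono_ae ?_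
    filter_upwards [hmem, hW₂] with s' hs' hs₂'
    refine lintegral_mono_ae ?_
    filter_upwards [hmem, hW₁] with t' ht' ht₁'
    have hcomm : ∀ x y : ℝ, o + x • b + y • a = o + y • a + x • b := fun x y => by abel
    simp_rw [hcomm] at hs₂ hs₂'
    have tri : ∀ x y z : ℝ, ENNReal.ofReal |x - z| ≤
        ENNReal.ofReal |x - y| + ENNReal.ofReal |y - z| := fun x y z => by
      rw [← ENNReal.ofReal_add (abs_nonneg _) (abs_nonneg _)]
      exact ENNReal.ofReal_le_ofReal (abs_sub_le x y z)
    rw [← sq_abs, sq, ENNReal.ofReal_mul (abs_nonneg _)]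
    refine mul_le_mul' ?_ ?_
    · exact (tri _ (f (o + s' • a + t • b)) _).trans
        (add_le_add (ht₁ s hs s' hs') (hs₂' t ht t' ht'))
    · exact (tri _ (f (o + s • a + t' • b)) _).trans
        (add_le_add (hs₂ t ht t' ht') (ht₁' s hs s' hs'))
  have hcalc : ∫⁻ s, ∫⁻ t, ∫⁻ s', ∫⁻ t', (W₁ t + W₂ s') * (W₂ s + W₁ t') ∂μ ∂μ ∂μ ∂μ =
      (I₁ + I₂) * (I₂ + I₁) := by
    have e1 : ∀ s t s', ∫⁻ t', (W₁ t + W₂ s') * (W₂ s + W₁ t') ∂μ =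
        (W₁ t + W₂ s') * (W₂ s + I₁) := by
      intro s t s'
      rw [lintegral_const_mul _ (mW₁.const_add _), lintegral_add_left measurable_const,
        lintegral_const, hμ, mul_one]
    have e2 : ∀ s t, ∫⁻ s', (W₁ t + W₂ s') * (W₂ s + I₁) ∂μ = (W₁ t + I₂) * (W₂ s + I₁) := by
      intro s t
      rw [lintegral_mul_const _ (mW₂.const_add _), lintegral_add_left measurable_const,
        lintegral_const, hμ, mul_one]
    have e3 : ∀ s, ∫⁻ t, (W₁ t + I₂) * (W₂ s + I₁) ∂μ = (I₁ + I₂) * (W₂ s + I₁) := by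
      intro s
      rw [lintegral_mul_const _ (mW₁.add_const _), lintegral_add_right _ measurable_const,
        lintegral_const, hμ, mul_one]
    simp_rw [e1, e2, e3]
    rw [lintegral_const_mul _ (mW₂.add_const _), lintegral_add_right _ measurable_const,
        lintegral_const, hμ, mul_one]
  rw [hsplit]
  calc c * c * _ ≤ c * c * ((I₁ + I₂) * (I₂ + I₁)) := by
        gcongr
        exact hbound.trans hcalc.le
    _ ≤ c * c * ((k₁ * V + k₂ * V) * (k₂ * V + k₁ * V)) := by
        gcongr
    _ = _ := by ring

/-- The Poincaré–Wirtinger inequality of functions of bounded variation, from `BV(Ω)` into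
`L²(Ω)`, for the piecewise constant functions on all the meshes of `Ω`. -/
theorem oscControlled_meshFamily {Ω : Set Plane} (hΩ : IsOpen Ω) (hc : IsPreconnected Ω)
    (hb : Bornology.IsBounded Ω) (hp : IsPolygonal Ω) :
    OscControlled (meshFamily Ω) Ω Ω := by
  refine OscControlled.of_parallelograms ?_ hΩ hc hb (isParallelogramUnion_of_isPolygonal hΩ hb hp)
    fun o a b h hP => oscControlled_meshFamily_openParallelogram hΩ h hP
  rintro _ ⟨T, Eint, Eext, _, _, M, u, rfl⟩
  exact M.measurable_value u

/-! ### Triangles inside the control volumes -/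

lemma mem_openTriangle_iff {x a b : Plane} (h : cross (a - x) (b - x) ≠ 0) (z : Plane) :
    z ∈ openTriangle x a b ↔ 0 < cross (z - x) (b - x) / cross (a - x) (b - x) ∧
      0 < cross (a - x) (z - x) / cross (a - x) (b - x) ∧
      cross (z - x) (b - x) / cross (a - x) (b - x) +
        cross (a - x) (z - x) / cross (a - x) (b - x) < 1 := by
  constructor
  · rintro ⟨p, q, r, hp, hq, hr, hs, rfl⟩
    obtain rfl : p = 1 - q - r := by linarith
    have e1 : cross ((1 - q - r) • x + q • a + r • b - x) (b - x) / cross (a - x) (b - x) = q := by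
      rw [div_eq_iff h]
      simp only [cross, PiLp.sub_apply, PiLp.add_apply, PiLp.smul_apply, smul_eq_mul]; ring
    have e2 : cross (a - x) ((1 - q - r) • x + q • a + r • b - x) / cross (a - x) (b - x) = r := by
      rw [div_eq_iff h]
      simp only [cross, PiLp.sub_apply, PiLp.add_apply, PiLp.smul_apply, smul_eq_mul]; ring
    rw [e1, e2]
    exact ⟨hq, hr, by linarith⟩
  · rintro ⟨h1, h2, h3⟩
    have := eq_smul_add_smul_of_cross_ne_zero h (z - x)
    generalize cross (z - x) (b - x) / cross (a - x) (b - x) = s at *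
    generalize cross (a - x) (z - x) / cross (a - x) (b - x) = t at *
    refine ⟨1 - s - t, s, t, by linarith, h1, h2, by ring, ?_⟩
    calc z = x + (z - x) := by abel
      _ = x + (s • (a - x) + t • (b - x)) := by rw [← this]
      _ = _ := by module

lemma isOpen_openTriangle {x a b : Plane} (h : cross (a - x) (b - x) ≠ 0) :
    IsOpen (openTriangle x a b) := by
  have : openTriangle x a b = {z | 0 < cross (z - x) (b - x) / cross (a - x) (b - x)} ∩
      ({z | 0 < cross (a - x) (z - x) / cross (a - x) (b - x)} ∩
      {z | cross (z - x) (b - x) / cross (a - x) (b - x) +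
        cross (a - x) (z - x) / cross (a - x) (b - x) < 1}) := by
    ext z; exact mem_openTriangle_iff h z
  rw [this]
  have c1 : Continuous fun z : Plane => cross (z - x) (b - x) / cross (a - x) (b - x) := by
    unfold cross; fun_prop
  have c2 : Continuous fun z : Plane => cross (a - x) (z - x) / cross (a - x) (b - x) := by
    unfold cross; fun_prop
  exact (isOpen_lt continuous_const c1).inter
    ((isOpen_lt continuous_const c2).inter (isOpen_lt (c1.add c2) continuous_const))

/-- The reference triangle. -/
def unitTriangle : Set Plane := openTriangle 0 !₂[1, 0] !₂[0, 1]

lemma mem_unitTriangle_iff (z : Plane) : z ∈ unitTriangle ↔ 0 < z 0 ∧ 0 < z 1 ∧ z 0 + z 1 < 1 := by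
  rw [unitTriangle, mem_openTriangle_iff (by simp [cross])]
  simp [cross]

lemma volume_unitTriangle_pos : 0 < volume unitTriangle := by
  refine (isOpen_openTriangle (by simp [cross])).measure_pos _ ⟨!₂[1 / 4, 1 / 4], ?_⟩
  change _ ∈ unitTriangle
  rw [mem_unitTriangle_iff]
  norm_num

lemma volume_unitTriangle_lt_top : volume unitTriangle < ⊤ := by
  have : unitTriangle ⊆ Metric.closedBall 0 2 := by
    intro z hz
    rw [mem_unitTriangle_iff] at hz
    rw [mem_closedBall_zero_iff, EuclideanSpace.norm_eq, Real.sqrt_le_left (by norm_num)]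
    simp only [Real.norm_eq_abs, sq_abs, Fin.sum_univ_two]
    nlinarith
  exact (measure_mono this).trans_lt measure_closedBall_lt_top

/-- The area of a triangle is proportional to the determinant of two of its sides. The factor,
the area of the reference triangle, is only needed to be positive and finite. -/
lemma volume_openTriangle (x a b : Plane) :
    volume (openTriangle x a b) =
      ENNReal.ofReal |cross (a - x) (b - x)| * volume unitTriangle := by
  let f : Plane →ₗ[ℝ] Plane :=
    { toFun := fun z => z 0 • (a - x) + z 1 • (b - x)
      map_add' := fun z w => by simp only [PiLp.add_apply]; module
      map_smul' := fun c z => by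
        simp only [PiLp.smul_apply, smul_eq_mul, RingHom.id_apply]; module }
  have hdet : LinearMap.det f = cross (a - x) (b - x) := by
    rw [← LinearMap.det_toMatrix (EuclideanSpace.basisFun (Fin 2) ℝ).toBasis, Matrix.det_fin_two]
    simp only [LinearMap.toMatrix_apply]
    simp [f, cross]
    ring
  have himg : openTriangle x a b = (fun z => x + z) '' (f '' unitTriangle) := by
    ext z
    constructor
    · rintro ⟨p, q, r, hp, hq, hr, hs, rfl⟩
      refine ⟨_, ⟨!₂[q, r], ?_, rfl⟩, ?_⟩
      · rw [mem_unitTriangle_iff]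
        exact ⟨hq, hr, by simp; linarith⟩
      · obtain rfl : p = 1 - q - r := by linarith
        simp [f]; module
    · rintro ⟨_, ⟨w, hw, rfl⟩, rfl⟩
      rw [mem_unitTriangle_iff] at hw
      refine ⟨1 - w 0 - w 1, w 0, w 1, by linarith, hw.1, hw.2.1, by ring, ?_⟩
      simp [f]; module
  rw [himg, image_add_left, measure_preimage_add, Measure.addHaar_image_linearMap, hdet]

lemma add_smul_sub_mem_affineSpan_openSegment (a b : Plane) (k : ℝ) :
    a + k • (b - a) ∈ affineSpan ℝ (openSegment ℝ a b) := by
  have h1 : (1 / 2 : ℝ) • a + (1 / 2 : ℝ) • b ∈ affineSpan ℝ (openSegment ℝ a b) :=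
    subset_affineSpan ℝ _ ⟨1 / 2, 1 / 2, by norm_num, by norm_num, by norm_num, rfl⟩
  have h2 : (1 / 4 : ℝ) • a + (3 / 4 : ℝ) • b ∈ affineSpan ℝ (openSegment ℝ a b) :=
    subset_affineSpan ℝ _ ⟨1 / 4, 3 / 4, by norm_num, by norm_num, by norm_num, rfl⟩
  have := AffineMap.lineMap_mem (4 * k - 2) h1 h2
  convert this using 1
  rw [AffineMap.lineMap_apply_module]
  module

lemma distToLine_le (x a b : Plane) (k : ℝ) :
    distToLine x (openSegment ℝ a b) ≤ dist x (a + k • (b - a)) :=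
  Metric.infDist_le_dist_of_mem (add_smul_sub_mem_affineSpan_openSegment a b k)

/-- Base times height is at most the determinant of two sides of the triangle. -/
lemma edgeLength_mul_distToLine_le (x a b : Plane) (h : a ≠ b) :
    edgeLength (openSegment ℝ a b) * distToLine x (openSegment ℝ a b) ≤
      |cross (a - x) (b - x)| := by
  have hp := sq_add_sq_pos (sub_ne_zero.2 h.symm)
  -- the orthogonal projection of `x` on the line
  set k := ((x 0 - a 0) * (b - a) 0 + (x 1 - a 1) * (b - a) 1) / ((b - a) 0 ^ 2 + (b - a) 1 ^ 2)
    with hk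
  have hk' : k * ((b - a) 0 ^ 2 + (b - a) 1 ^ 2) =
      (x 0 - a 0) * (b - a) 0 + (x 1 - a 1) * (b - a) 1 := by
    rw [hk]; field_simp
  calc edgeLength (openSegment ℝ a b) * distToLine x (openSegment ℝ a b)
      ≤ dist a b * dist x (a + k • (b - a)) := by
        rw [edgeLength_openSegment]
        exact mul_le_mul_of_nonneg_left (distToLine_le x a b k) dist_nonneg
    _ ≤ _ := by
        refine le_of_sq_le_sq ?_ (abs_nonneg _)
        rw [mul_pow, sq_abs, dist_comm, dist_eq_norm, dist_eq_norm, EuclideanSpace.real_norm_sq_eq,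
          EuclideanSpace.real_norm_sq_eq, Fin.sum_univ_two, Fin.sum_univ_two]
        simp only [cross, PiLp.sub_apply, PiLp.add_apply, PiLp.smul_apply, smul_eq_mul] at hk' ⊢
        apply le_of_eq
        linear_combination (k * ((b 0 - a 0) ^ 2 + (b 1 - a 1) ^ 2) -
          ((x 0 - a 0) * (b 0 - a 0) + (x 1 - a 1) * (b 1 - a 1))) * hk'

/-- Rescaling a point of the cone with apex `x` over a segment to a point of this segment. -/
lemma add_inv_smul_mem_openSegment (x a b : Plane) {q r : ℝ} (hq : 0 < q) (hr : 0 < r) :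
    x + (q + r)⁻¹ • (q • (a - x) + r • (b - x)) ∈ openSegment ℝ a b := by
  have hqr : 0 < q + r := by positivity
  refine ⟨q / (q + r), r / (q + r), by positivity, by positivity, by field_simp, ?_⟩
  have e : x = ((q + r)⁻¹ * (q + r)) • x := by rw [inv_mul_cancel₀ hqr.ne', one_smul]
  nth_rw 1 [e]
  simp only [div_eq_inv_mul]
  module

namespace PolygonalMesh

variable {Ω : Set Plane} {T Eint Eext : Type} (M : PolygonalMesh Ω T Eint Eext)

lemma add_smul_mem_closure_cell {K : T} {y : Plane} (hy : y ∈ closure (M.cell K)) {l : ℝ}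
    (h0 : 0 ≤ l) (h1 : l ≤ 1) : M.center K + l • (y - M.center K) ∈ closure (M.cell K) := by
  refine map_mem_closure (f := fun y => M.center K + l • (y - M.center K)) (by fun_prop) hy ?_
  intro y hy
  exact (M.starConvex_cell K).add_smul_sub_mem hy h0 h1

/-- The triangle with apex `x_K` and base an edge of `K` is contained in the closure of `K`. -/
lemma openTriangle_subset_closure_cell {K : T} {σ : Eint} {a b : Plane}
    (hσ : M.inner σ = openSegment ℝ a b) (hK : M.left σ = K ∨ M.right σ = K) :
    openTriangle (M.center K) a b ⊆ closure (M.cell K) := by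
  rintro z ⟨p, q, r, hp, hq, hr, hs, rfl⟩
  have hqr : 0 < q + r := by positivity
  have hy : (q / (q + r)) • a + (r / (q + r)) • b ∈ closure (M.cell K) := by
    have h1 : closure (M.inner σ) ⊆ frontier (M.cell K) := by
      rcases hK with rfl | rfl
      · exact M.closure_inner_subset_frontier_left σ
      · exact M.closure_inner_subset_frontier_right σ
    apply frontier_subset_closure (h1 (subset_closure _))
    rw [hσ]
    exact ⟨_, _, by positivity, by positivity, by field_simp, rfl⟩
  have := M.add_smul_mem_closure_cell hy hqr.le (by linarith)
  convert this using 1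
  obtain rfl : p = 1 - (q + r) := by linarith
  have e1 : (q + r) • ((q / (q + r)) • a + (r / (q + r)) • b) = q • a + r • b := by
    rw [smul_add, smul_smul, smul_smul, mul_div_cancel₀ _ hqr.ne', mul_div_cancel₀ _ hqr.ne']
  rw [smul_sub, e1]; module

/-- An edge of `K` hides from `x_K` what lies behind it: in the cone over this edge, the closure of
`K` stays on the same side as `x_K`. -/
lemma add_le_one_of_mem_closure_cell {K : T} {σ : Eint} {a b : Plane}
    (hσ : M.inner σ = openSegment ℝ a b) (hc : cross (a - M.center K) (b - M.center K) ≠ 0)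
    {s t : ℝ} (hs : 0 < s) (ht : 0 < t)
    (hw : M.center K + s • (a - M.center K) + t • (b - M.center K) ∈ closure (M.cell K)) :
    s + t ≤ 1 := by
  by_contra! hst
  set x := M.center K
  set f : Plane → ℝ := fun z => cross (z - x) (b - x) / cross (a - x) (b - x)
  set g : Plane → ℝ := fun z => cross (a - x) (z - x) / cross (a - x) (b - x)
  have cf : Continuous f := by simp only [f]; unfold cross; fun_prop
  have cg : Continuous g := by simp only [g]; unfold cross; fun_prop
  have hf : f (x + s • (a - x) + t • (b - x)) = s := by
    simp only [f]; rw [div_eq_iff hc]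
    simp only [cross, PiLp.sub_apply, PiLp.add_apply, PiLp.smul_apply, smul_eq_mul]; ring
  have hg : g (x + s • (a - x) + t • (b - x)) = t := by
    simp only [g]; rw [div_eq_iff hc]
    simp only [cross, PiLp.sub_apply, PiLp.add_apply, PiLp.smul_apply, smul_eq_mul]; ring
  have hopen : IsOpen {z | 0 < f z ∧ 0 < g z ∧ 1 < f z + g z} :=
    (isOpen_lt continuous_const cf).inter ((isOpen_lt continuous_const cg).inter
      (isOpen_lt continuous_const (cf.add cg)))
  obtain ⟨k, ⟨hk1, hk2, hk3⟩, hkK⟩ := mem_closure_iff.1 hw _ hopen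
    ⟨by rw [hf]; exact hs, by rw [hg]; exact ht, by rw [hf, hg]; exact hst⟩
  have hk : k - x = f k • (a - x) + g k • (b - x) := eq_smul_add_smul_of_cross_ne_zero hc (k - x)
  have hpos : 0 < f k + g k := by linarith
  have hin : x + (f k + g k)⁻¹ • (k - x) ∈ M.cell K :=
    (M.starConvex_cell K).add_smul_sub_mem hkK (by positivity) (inv_le_one_of_one_le₀ hk3.le)
  refine disjoint_left.1 (M.disjoint_inner_cell σ K) ?_ hin
  rw [hσ]
  rw [hk]
  exact add_inv_smul_mem_openSegment x a b hk1 hk2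

lemma disjoint_openTriangle {K : T} {σ τ : Eint} (hne : σ ≠ τ) {a b a' b' : Plane}
    (hσ : M.inner σ = openSegment ℝ a b) (hτ : M.inner τ = openSegment ℝ a' b')
    (hσK : M.left σ = K ∨ M.right σ = K) (hτK : M.left τ = K ∨ M.right τ = K)
    (hc : cross (a - M.center K) (b - M.center K) ≠ 0)
    (hc' : cross (a' - M.center K) (b' - M.center K) ≠ 0) :
    Disjoint (openTriangle (M.center K) a b) (openTriangle (M.center K) a' b') := by
  rw [disjoint_left]
  rintro z ⟨p, q, r, hp, hq, hr, hs, rfl⟩ ⟨p', q', r', hp', hq', hr', hs', hz⟩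
  set x := M.center K
  have hcl : ∀ σ : Eint, (M.left σ = K ∨ M.right σ = K) → M.inner σ ⊆ closure (M.cell K) := by
    rintro σ (rfl | rfl)
    · exact subset_closure.trans ((M.closure_inner_subset_frontier_left σ).trans
        frontier_subset_closure)
    · exact subset_closure.trans ((M.closure_inner_subset_frontier_right σ).trans
        frontier_subset_closure)
  have hqr : 0 < q + r := by positivity
  have hqr' : 0 < q' + r' := by positivity
  obtain rfl : p = 1 - (q + r) := by linarith
  obtain rfl : p' = 1 - (q' + r') := by linarith
  have hz' : q • (a - x) + r • (b - x) = q' • (a' - x) + r' • (b' - x) := by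
    have e1 : (1 - (q + r)) • x + q • a + r • b = x + (q • (a - x) + r • (b - x)) := by module
    have e2 : (1 - (q' + r')) • x + q' • a' + r' • b' = x + (q' • (a' - x) + r' • (b' - x)) := by
      module
    rw [e1, e2] at hz
    exact add_left_cancel hz
  have hle : q' + r' ≤ q + r := by
    have h1 := hcl σ hσK (hσ ▸ add_inv_smul_mem_openSegment x a b hq hr)
    rw [hz'] at h1
    have := M.add_le_one_of_mem_closure_cell hτ hc' (s := (q + r)⁻¹ * q') (t := (q + r)⁻¹ * r')
      (by positivity) (by positivity) (by convert h1 using 1; module)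
    rw [← mul_add, inv_mul_le_iff₀ hqr] at this
    linarith
  have hle' : q + r ≤ q' + r' := by
    have h1 := hcl τ hτK (hτ ▸ add_inv_smul_mem_openSegment x a' b' hq' hr')
    rw [← hz'] at h1
    have := M.add_le_one_of_mem_closure_cell hσ hc (s := (q' + r')⁻¹ * q) (t := (q' + r')⁻¹ * r)
      (by positivity) (by positivity) (by convert h1 using 1; module)
    rw [← mul_add, inv_mul_le_iff₀ hqr'] at this
    linarith
  have h1 := add_inv_smul_mem_openSegment x a b hq hr
  have h2 := add_inv_smul_mem_openSegment x a' b' hq' hr'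
  rw [hz', le_antisymm hle' hle, ← hσ] at h1
  rw [← hτ] at h2
  exact disjoint_left.1 (M.inner_disjoint hne) h1 h2

lemma volume_frontier_cell [Finite Eint] [Finite Eext] (K : T) :
    volume (frontier (M.cell K)) = 0 := by
  have hE : ∀ σ, IsEdge σ → volume (closure σ) = 0 := by
    rintro _ ⟨a, b, hab, rfl⟩
    rw [closure_openSegment]
    exact volume_segment hab
  rw [M.frontier_cell]
  refine measure_union_null ?_ ?_
  · exact (measure_biUnion_null_iff (to_countable _)).2 fun σ _ => hE _ (M.isEdge_inner σ)
  · exact (measure_biUnion_null_iff (to_countable _)).2 fun σ _ => hE _ (M.isEdge_outer σ)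

/-- The triangles with apex `x_K` over the interior edges of `K` fit into `K` without overlapping,
so that their total area is at most the area of `K`. -/
lemma sum_edgeLength_mul_distToLine_le [Fintype Eint] [Finite Eext] [DecidableEq T]
    (hb : Bornology.IsBounded Ω) (K : T)
    (hpos : ∀ σ, M.left σ = K ∨ M.right σ = K → 0 < distToLine (M.center K) (M.inner σ)) :
    ∑ σ with M.left σ = K ∨ M.right σ = K,
      edgeLength (M.inner σ) * distToLine (M.center K) (M.inner σ) ≤
      (volume unitTriangle).toReal⁻¹ * M.area K := by
  choose a b hab hσ using M.isEdge_inner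
  have hle : ∀ σ, edgeLength (M.inner σ) * distToLine (M.center K) (M.inner σ) ≤
      |cross (a σ - M.center K) (b σ - M.center K)| := by
    intro σ; rw [hσ]; exact edgeLength_mul_distToLine_le _ _ _ (hab σ)
  have hc : ∀ σ, M.left σ = K ∨ M.right σ = K →
      cross (a σ - M.center K) (b σ - M.center K) ≠ 0 := by
    intro σ hK h0
    have h1 := hle σ
    rw [h0, abs_zero] at h1
    have h2 : 0 < edgeLength (M.inner σ) := by
      rw [hσ, edgeLength_openSegment]; exact dist_pos.2 (hab σ)
    exact absurd h1 (not_le.2 (mul_pos h2 (hpos σ hK)))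
  have hκ : 0 < (volume unitTriangle).toReal :=
    ENNReal.toReal_pos volume_unitTriangle_pos.ne' volume_unitTriangle_lt_top.ne
  have hK : volume (M.cell K) ≠ ⊤ := (hb.subset (M.cell_subset K)).measure_lt_top.ne
  rw [le_inv_mul_iff₀ hκ]
  refine le_trans ?_ (show _ ≤ M.area K from ENNReal.toReal_mono hK
    (?_ : volume (⋃ σ ∈ Finset.univ.filter fun σ => M.left σ = K ∨ M.right σ = K,
      openTriangle (M.center K) (a σ) (b σ)) ≤ _))
  · rw [measure_biUnion_finset, ENNReal.toReal_sum, Finset.mul_sum]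
    · refine Finset.sum_le_sum fun σ _ => ?_
      rw [volume_openTriangle, ENNReal.toReal_mul, ENNReal.toReal_ofReal (abs_nonneg _), mul_comm]
      exact mul_le_mul_of_nonneg_right (hle σ) hκ.le
    · intro σ _
      rw [volume_openTriangle]
      exact ENNReal.mul_ne_top ENNReal.ofReal_ne_top volume_unitTriangle_lt_top.ne
    · intro σ hs τ ht hne
      simp only [Finset.coe_filter, Finset.mem_univ, true_and, mem_ofPred_eq] at hs ht
      exact M.disjoint_openTriangle hne (hσ σ) (hσ τ) hs ht (hc σ hs) (hc τ ht)
    · intro σ hs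
      exact (isOpen_openTriangle (hc σ (by simpa using hs))).measurableSet
  · have hcl : volume (closure (M.cell K)) = volume (M.cell K) := by
      apply le_antisymm _ (measure_mono subset_closure)
      rw [closure_eq_self_union_frontier]
      refine (measure_union_le _ _).trans ?_
      rw [M.volume_frontier_cell, add_zero]
    rw [← hcl]
    refine measure_mono (iUnion₂_subset fun σ hs => ?_)
    exact M.openTriangle_subset_closure_cell (hσ σ) (by simpa using hs)

/-- The centers of two neighbouring control volumes lie on opposite sides of their common edge,
otherwise the triangles over this edge would overlap. Hence the distance of a center to the edge
is at most the distance between the centers. -/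
lemma distToLine_le_dInner (σ : Eint)
    (hl : 0 < distToLine (M.center (M.left σ)) (M.inner σ))
    (hr : 0 < distToLine (M.center (M.right σ)) (M.inner σ)) :
    distToLine (M.center (M.left σ)) (M.inner σ) ≤ M.dInner σ := by
  obtain ⟨a, b, hab, hσ⟩ := M.isEdge_inner σ
  have hcr : ∀ K, 0 < distToLine (M.center K) (M.inner σ) →
      cross (a - M.center K) (b - M.center K) ≠ 0 := by
    intro K hK h0
    have h1 := edgeLength_mul_distToLine_le (M.center K) a b hab
    rw [h0, abs_zero, ← hσ] at h1
    have h2 : 0 < edgeLength (M.inner σ) := by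
      rw [hσ, edgeLength_openSegment]; exact dist_pos.2 hab
    exact absurd h1 (not_le.2 (mul_pos h2 hK))
  have hcl := hcr _ hl
  have hcr := hcr _ hr
  set x := M.center (M.left σ) with hx
  set y := M.center (M.right σ) with hy
  set s := cross (y - x) (b - x) / cross (a - x) (b - x)
  set t := cross (a - x) (y - x) / cross (a - x) (b - x)
  have hyx : y - x = s • (a - x) + t • (b - x) := eq_smul_add_smul_of_cross_ne_zero hcl (y - x)
  rcases le_or_gt 1 (s + t) with hst | hst
  · -- the segment between the centers meets the line carrying the edge
    have hst0 : 0 < s + t := by linarith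
    rw [hσ]
    refine (distToLine_le x a b (t / (s + t))).trans ?_
    have e : a + (t / (s + t)) • (b - a) = x + (s + t)⁻¹ • (y - x) := by
      rw [hyx]
      have e : a = ((s + t)⁻¹ * (s + t)) • a := by rw [inv_mul_cancel₀ hst0.ne', one_smul]
      have e' : x = ((s + t)⁻¹ * (s + t)) • x := by rw [inv_mul_cancel₀ hst0.ne', one_smul]
      nth_rw 1 [e]
      nth_rw 1 [e']
      rw [div_eq_inv_mul]
      module
    rw [e, dist_self_add_right, norm_smul, Real.norm_of_nonneg (by positivity), dInner, ← hx, ← hy,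
      dist_comm, dist_eq_norm]
    exact mul_le_of_le_one_left (norm_nonneg _) (inv_le_one_of_one_le₀ hst)
  · exfalso
    set ε := 1 / (4 * (1 + |s| + |t|)) with hε
    have hD : 0 < 1 + |s| + |t| := by positivity
    have hε0 : 0 < ε := by positivity
    have hεD : ε * (1 + |s| + |t|) = 1 / 4 := by rw [hε]; field_simp
    have hs1 := neg_abs_le s
    have ht1 := neg_abs_le t
    have hs2 := mul_nonneg hε0.le (abs_nonneg s)
    have ht2 := mul_nonneg hε0.le (abs_nonneg t)
    have hs3 := mul_le_mul_of_nonneg_left hs1 hε0.le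
    have ht3 := mul_le_mul_of_nonneg_left ht1 hε0.le
    -- a point of both triangles, close to the midpoint of the edge
    set w := ε • y + ((1 - ε) / 2) • a + ((1 - ε) / 2) • b
    have hwr : w ∈ openTriangle y a b :=
      ⟨ε, (1 - ε) / 2, (1 - ε) / 2, hε0, by nlinarith, by nlinarith, by ring, rfl⟩
    have hwl : w ∈ openTriangle x a b := by
      refine ⟨ε * (1 - (s + t)), (1 - ε) / 2 + ε * s, (1 - ε) / 2 + ε * t,
        mul_pos hε0 (by linarith), by nlinarith, by nlinarith, by ring, ?_⟩
      have : y = x + (s • (a - x) + t • (b - x)) := by rw [← hyx]; abel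
      simp only [w]
      rw [this]
      module
    have hU := (isOpen_openTriangle hcl).inter (isOpen_openTriangle hcr)
    have hsl := M.openTriangle_subset_closure_cell hσ (Or.inl (rfl : M.left σ = _))
    have hsr := M.openTriangle_subset_closure_cell hσ (Or.inr (rfl : M.right σ = _))
    obtain ⟨k, hk, hkl⟩ := mem_closure_iff.1 (hsl hwl) _ hU ⟨hwl, hwr⟩
    obtain ⟨m, ⟨-, hml⟩, hmr⟩ := mem_closure_iff.1 (hsr hk.2) _
      (hU.inter (M.isOpen_cell (M.left σ))) ⟨hk, hkl⟩
    exact disjoint_left.1 (M.cell_disjoint (M.left_ne_right σ)) hml hmr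

end PolygonalMesh

/-! ### Inequalities for weighted finite sums -/

section Weighted

variable {T : Type*} [Fintype T]

lemma exists_median {m : T → ℝ} (hm : ∀ K, 0 ≤ m K) (hpos : 0 < ∑ K, m K) (f : T → ℝ) :
    ∃ c, (∑ K, m K) / 2 ≤ ∑ K with f K ≤ c, m K ∧ (∑ K, m K) / 2 ≤ ∑ K with c ≤ f K, m K := by
  classical
  have hT : Nonempty T := by
    by_contra h
    rw [not_nonempty_iff] at h
    simp at hpos
  set A := ∑ K, m K
  set S : Finset T := Finset.univ.filter fun K => A / 2 ≤ ∑ L with f L ≤ f K, m L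
  have hS : S.Nonempty := by
    obtain ⟨K, -, hK⟩ := Finset.exists_max_image Finset.univ f Finset.univ_nonempty
    refine ⟨K, Finset.mem_filter.2 ⟨Finset.mem_univ _, ?_⟩⟩
    rw [Finset.filter_true_of_mem fun L _ => hK L (Finset.mem_univ _)]
    change A / 2 ≤ A
    linarith
  obtain ⟨K, hKS, hK⟩ := Finset.exists_min_image S f hS
  refine ⟨f K, (Finset.mem_filter.1 hKS).2, ?_⟩
  have hsplit : ∑ L with f K ≤ f L, m L + ∑ L with ¬ f K ≤ f L, m L = A :=
    Finset.sum_filter_add_sum_filter_not _ _ _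
  by_contra! hlt
  have hbig : A / 2 < ∑ L with ¬ f K ≤ f L, m L := by linarith
  have hne : (Finset.univ.filter fun L => ¬ f K ≤ f L).Nonempty := by
    rw [Finset.nonempty_iff_ne_empty]
    intro h
    rw [h, Finset.sum_empty] at hbig
    linarith
  obtain ⟨L, hL, hLmax⟩ := Finset.exists_max_image _ f hne
  have hLK : f L < f K := by simpa using hL
  have hLS : L ∈ S := by
    refine Finset.mem_filter.2 ⟨Finset.mem_univ _, hbig.le.trans ?_⟩
    refine Finset.sum_le_sum_of_subset_of_nonneg (fun N hN => ?_) fun N _ _ => hm N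
    exact Finset.mem_filter.2 ⟨Finset.mem_univ _, hLmax N hN⟩
  exact absurd (hK L hLS) (not_le.2 hLK)

/-- A function with median `0` is controlled by its differences: each value is compared with the
values of the opposite sign, whose weight is at least one half. -/
lemma half_mul_sum_sq_le {m : T → ℝ} (hm : ∀ K, 0 ≤ m K) {g : T → ℝ}
    (h₁ : (∑ K, m K) / 2 ≤ ∑ K with g K ≤ 0, m K) (h₂ : (∑ K, m K) / 2 ≤ ∑ K with 0 ≤ g K, m K) :
    (∑ K, m K) / 2 * ∑ K, m K * g K ^ 2 ≤ ∑ K, ∑ L, m K * m L * (g K - g L) ^ 2 := by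
  classical
  rw [Finset.mul_sum]
  refine Finset.sum_le_sum fun K _ => ?_
  have key : (∑ L, m L) / 2 * g K ^ 2 ≤ ∑ L, m L * (g K - g L) ^ 2 := by
    have aux : ∀ P : T → Prop, (∑ L, m L) / 2 ≤ ∑ L with P L, m L →
        (∀ L, P L → g K ^ 2 ≤ (g K - g L) ^ 2) →
        (∑ L, m L) / 2 * g K ^ 2 ≤ ∑ L, m L * (g K - g L) ^ 2 := by
      intro P hP hg
      calc (∑ L, m L) / 2 * g K ^ 2 ≤ (∑ L with P L, m L) * g K ^ 2 :=
            mul_le_mul_of_nonneg_right hP (sq_nonneg _)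
        _ = ∑ L with P L, m L * g K ^ 2 := Finset.sum_mul _ _ _
        _ ≤ ∑ L with P L, m L * (g K - g L) ^ 2 := Finset.sum_le_sum fun L hL =>
            mul_le_mul_of_nonneg_left (hg L (Finset.mem_filter.1 hL).2) (hm L)
        _ ≤ _ := Finset.sum_le_sum_of_subset_of_nonneg (Finset.filter_subset _ _)
            fun L _ _ => mul_nonneg (hm L) (sq_nonneg _)
    rcases le_total 0 (g K) with hK | hK
    · exact aux _ h₁ fun L hL => by nlinarith
    · exact aux _ h₂ fun L hL => by nlinarith
  calc (∑ L, m L) / 2 * (m K * g K ^ 2) = m K * ((∑ L, m L) / 2 * g K ^ 2) := by ring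
    _ ≤ m K * ∑ L, m L * (g K - g L) ^ 2 := mul_le_mul_of_nonneg_left key (hm K)
    _ = _ := by rw [Finset.mul_sum]; simp_rw [mul_assoc]

/-- The Tsallis entropy is at most a variance. The equality of the two masses enters through
`∑ μ h ^ (p / 2) ≤ ∑ μ`, a consequence of the concavity of `s ↦ s ^ (p / 2)`. -/
lemma sum_tsallisPhi_le {μ h : T → ℝ} {S p c : ℝ} (hμ : ∀ K, 0 ≤ μ K) (hh : ∀ K, 0 < h K)
    (hS : ∑ K, μ K = S) (hS' : ∑ K, μ K * h K = S) (hp : 1 < p) (hp' : p ≤ 2) :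
    ∑ K, μ K * tsallisPhi p (h K) ≤ (p - 1)⁻¹ * ∑ K, μ K * (h K ^ (p / 2) - c) ^ 2 := by
  have hp0 : 0 < p - 1 := by linarith
  have hpow : ∀ K, (h K ^ (p / 2)) ^ 2 = h K ^ p := by
    intro K
    rw [← Real.rpow_natCast, ← Real.rpow_mul (hh K).le]
    norm_num
  set B := ∑ K, μ K * h K ^ (p / 2)
  have hB0 : 0 ≤ B := Finset.sum_nonneg fun K _ => mul_nonneg (hμ K) (Real.rpow_nonneg (hh K).le _)
  have hBS : B ≤ S := by
    have : ∀ K, μ K * h K ^ (p / 2) ≤ (1 - p / 2) * μ K + p / 2 * (μ K * h K) := by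
      intro K
      have h1 := rpow_one_add_le_one_add_mul_self (s := h K - 1) (by linarith [hh K])
        (p := p / 2) (by linarith) (by linarith)
      rw [add_sub_cancel] at h1
      nlinarith [mul_le_mul_of_nonneg_left h1 (hμ K)]
    calc B ≤ ∑ K, ((1 - p / 2) * μ K + p / 2 * (μ K * h K)) := Finset.sum_le_sum fun K _ => this K
      _ = S := by
        rw [Finset.sum_add_distrib, ← Finset.mul_sum, ← Finset.mul_sum, hS, hS']; ring
  have e1 : ∑ K, μ K * tsallisPhi p (h K) = (p - 1)⁻¹ * (∑ K, μ K * h K ^ p - S) := by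
    have : ∀ K, μ K * tsallisPhi p (h K) =
        (p - 1)⁻¹ * (μ K * h K ^ p) - (p - 1)⁻¹ * p * (μ K * h K) + μ K := by
      intro K; rw [tsallisPhi]; field_simp
    simp_rw [this]
    rw [Finset.sum_add_distrib, Finset.sum_sub_distrib, ← Finset.mul_sum, ← Finset.mul_sum, hS, hS']
    field_simp
    ring
  have e2 : ∑ K, μ K * (h K ^ (p / 2) - c) ^ 2 = ∑ K, μ K * h K ^ p - 2 * c * B + c ^ 2 * S := by
    have : ∀ K, μ K * (h K ^ (p / 2) - c) ^ 2 =
        μ K * h K ^ p - 2 * c * (μ K * h K ^ (p / 2)) + c ^ 2 * μ K := by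
      intro K; rw [← hpow K]; ring
    simp_rw [this]
    rw [Finset.sum_add_distrib, Finset.sum_sub_distrib, ← Finset.mul_sum, ← Finset.mul_sum, hS]
  rw [e1, e2]
  refine mul_le_mul_of_nonneg_left ?_ (by positivity)
  nlinarith [mul_nonneg hB0 (sq_nonneg (c - 1)), mul_nonneg (sub_nonneg.2 hBS) (sq_nonneg c)]

/-- The Boltzmann entropy is controlled by the fourth moment of `√h - c`. By concavity of the
logarithm it is at most `S log (∑ μ h² / S)`, and `∑ μ h²` is compared with `S` by writing
`√h = c + g`. -/
lemma sum_boltzmannPhi_le {μ h : T → ℝ} {S c : ℝ} (hμ : ∀ K, 0 ≤ μ K) (hh : ∀ K, 0 < h K)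
    (hS0 : 0 < S) (hS : ∑ K, μ K = S) (hS' : ∑ K, μ K * h K = S) :
    ∑ K, μ K * boltzmannPhi (h K) ≤ 16 * √(S * ∑ K, μ K * (√(h K) - c) ^ 4) := by
  set g : T → ℝ := fun K => √(h K) - c with hg
  have hsq : ∀ K, h K = (g K + c) ^ 2 := by
    intro K; simp only [hg, sub_add_cancel]; rw [Real.sq_sqrt (hh K).le]
  set G₂ := ∑ K, μ K * g K ^ 2 with hG₂
  set G₄ := ∑ K, μ K * g K ^ 4 with hG₄
  have hG₂0 : 0 ≤ G₂ := Finset.sum_nonneg fun K _ => mul_nonneg (hμ K) (sq_nonneg _)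
  have hG₄0 : 0 ≤ G₄ := Finset.sum_nonneg fun K _ => mul_nonneg (hμ K) (by positivity)
  have hCS : G₂ ^ 2 ≤ S * G₄ := by
    rw [← hS]
    refine Finset.sum_sq_le_sum_mul_sum_of_sq_le_mul _ (fun K _ => hμ K)
      (fun K _ => mul_nonneg (hμ K) (by positivity)) fun K _ => le_of_eq (by ring)
  set D := √(S * G₄) / S with hD
  have hD0 : 0 ≤ D := by positivity
  have hDS : S * D = √(S * G₄) := by rw [hD]; field_simp
  have hG₂D : G₂ ≤ S * D := by rw [hDS]; exact Real.le_sqrt_of_sq_le hCS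
  have hG₄D : G₄ = S * D ^ 2 := by
    have : (S * D) ^ 2 = S * G₄ := by rw [hDS, Real.sq_sqrt (by positivity)]
    have h' : S * (S * D ^ 2) = S * G₄ := by rw [← this]; ring
    exact (mul_left_cancel₀ hS0.ne' h').symm
  have hc : c ^ 2 * S ≤ 2 * S + 2 * G₂ := by
    have : ∀ K, c ^ 2 * μ K ≤ 2 * (μ K * h K) + 2 * (μ K * g K ^ 2) := by
      intro K
      rw [hsq K]
      nlinarith [mul_nonneg (hμ K) (sq_nonneg (2 * g K + c))]
    calc c ^ 2 * S = ∑ K, c ^ 2 * μ K := by rw [← Finset.mul_sum, hS]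
      _ ≤ ∑ K, (2 * (μ K * h K) + 2 * (μ K * g K ^ 2)) := Finset.sum_le_sum fun K _ => this K
      _ = _ := by rw [Finset.sum_add_distrib, ← Finset.mul_sum, ← Finset.mul_sum, hS']
  have hQ : ∑ K, μ K * h K ^ 2 ≤ S + 2 * G₄ + 8 * c ^ 2 * G₂ := by
    have : ∀ K, μ K * h K ^ 2 ≤ 2 * (c ^ 2 * (μ K * h K)) - c ^ 4 * μ K +
        (2 * (μ K * g K ^ 4) + 8 * c ^ 2 * (μ K * g K ^ 2)) := by
      intro K
      have h1 : (h K - c ^ 2) ^ 2 ≤ 2 * g K ^ 4 + 8 * c ^ 2 * g K ^ 2 := by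
        rw [hsq K]
        nlinarith [sq_nonneg (g K * (g K - 2 * c))]
      nlinarith [mul_le_mul_of_nonneg_left h1 (hμ K)]
    calc ∑ K, μ K * h K ^ 2 ≤ ∑ K, (2 * (c ^ 2 * (μ K * h K)) - c ^ 4 * μ K +
        (2 * (μ K * g K ^ 4) + 8 * c ^ 2 * (μ K * g K ^ 2))) := Finset.sum_le_sum fun K _ => this K
      _ = 2 * (c ^ 2 * S) - c ^ 4 * S + (2 * G₄ + 8 * c ^ 2 * G₂) := by
        simp only [Finset.sum_add_distrib, Finset.sum_sub_distrib, ← Finset.mul_sum, hS, hS']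
        rfl
      _ ≤ _ := by nlinarith [mul_nonneg hS0.le (sq_nonneg (c ^ 2 - 1))]
  set l := (1 + 8 * D) ^ 2 with hl
  have hl0 : 0 < l := by positivity
  have hQl : ∑ K, μ K * h K ^ 2 ≤ S * l := by
    have h1 : c ^ 2 ≤ 2 + 2 * D := by
      have : c ^ 2 * S ≤ (2 + 2 * D) * S := by linarith
      exact le_of_mul_le_mul_right this hS0
    have h2 : c ^ 2 * G₂ ≤ (2 + 2 * D) * (S * D) := by gcongr
    have h3 : 0 ≤ S * D ^ 2 := by positivity
    rw [hl]
    nlinarith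
  have hlog : Real.log l ≤ 16 * D := by
    rw [hl, Real.log_pow]
    have := Real.log_le_sub_one_of_pos (show 0 < 1 + 8 * D by positivity)
    push_cast
    linarith
  -- the tangent line at `l` bounds the logarithm
  have hterm : ∀ K, μ K * boltzmannPhi (h K) ≤
      l⁻¹ * (μ K * h K ^ 2) + (Real.log l - 2) * (μ K * h K) + μ K := by
    intro K
    have h1 := Real.log_le_sub_one_of_pos (show 0 < h K / l from div_pos (hh K) hl0)
    rw [Real.log_div (hh K).ne' hl0.ne'] at h1
    have h2 : h K * Real.log (h K) ≤ h K * (h K / l - 1 + Real.log l) :=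
      mul_le_mul_of_nonneg_left (by linarith) (hh K).le
    have h3 : boltzmannPhi (h K) ≤ l⁻¹ * h K ^ 2 + (Real.log l - 2) * h K + 1 := by
      rw [boltzmannPhi]
      have : h K * (h K / l - 1 + Real.log l) = l⁻¹ * h K ^ 2 - h K + Real.log l * h K := by
        rw [div_eq_inv_mul]; ring
      linarith
    have := mul_le_mul_of_nonneg_left h3 (hμ K)
    linarith
  calc ∑ K, μ K * boltzmannPhi (h K)
      ≤ ∑ K, (l⁻¹ * (μ K * h K ^ 2) + (Real.log l - 2) * (μ K * h K) + μ K) :=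
        Finset.sum_le_sum fun K _ => hterm K
    _ = l⁻¹ * ∑ K, μ K * h K ^ 2 + (Real.log l - 2) * S + S := by
        rw [Finset.sum_add_distrib, Finset.sum_add_distrib, ← Finset.mul_sum, ← Finset.mul_sum,
          hS, hS']
    _ ≤ S + (16 * D - 2) * S + S := by
        have : l⁻¹ * ∑ K, μ K * h K ^ 2 ≤ S := by
          rw [inv_mul_le_iff₀ hl0]; linarith
        have := mul_le_mul_of_nonneg_right hlog hS0.le
        nlinarith
    _ = 16 * (S * D) := by ring
    _ = _ := by rw [hDS]

end Weighted

/-! ### Discrete Poincaré–Wirtinger and Poincaré–Sobolev inequalities -/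

namespace PolygonalMesh

variable {Ω : Set Plane} {T Eint Eext : Type} (M : PolygonalMesh Ω T Eint Eext)

lemma area_nonneg (K : T) : 0 ≤ M.area K := ENNReal.toReal_nonneg

lemma area_pos (hb : Bornology.IsBounded Ω) (K : T) : 0 < M.area K :=
  ENNReal.toReal_pos ((M.isOpen_cell K).measure_pos _ ⟨_, M.center_mem K⟩).ne'
    (hb.subset (M.cell_subset K)).measure_lt_top.ne

lemma dInner_pos (σ : Eint) : 0 < M.dInner σ := by
  refine dist_pos.2 fun h => ?_
  refine disjoint_left.1 (M.cell_disjoint (M.left_ne_right σ)) (M.center_mem _) ?_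
  rw [h]
  exact M.center_mem _

variable [Fintype Eint]

lemma dirichletEnergy_nonneg (f : T → ℝ) : 0 ≤ M.dirichletEnergy f :=
  Finset.sum_nonneg fun _ _ =>
    mul_nonneg (div_nonneg (edgeLength_nonneg _) dist_nonneg) (sq_nonneg _)

lemma variation_nonneg (u : T → ℝ) : 0 ≤ M.variation u :=
  Finset.sum_nonneg fun _ _ => mul_nonneg (edgeLength_nonneg _) (abs_nonneg _)

lemma sq_sum_edgeLength_mul_le (f : T → ℝ) (w : Eint → ℝ) :
    (∑ σ, edgeLength (M.inner σ) * |f (M.left σ) - f (M.right σ)| * w σ) ^ 2 ≤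
      M.dirichletEnergy f * ∑ σ, edgeLength (M.inner σ) * M.dInner σ * w σ ^ 2 := by
  refine Finset.sum_sq_le_sum_mul_sum_of_sq_le_mul _ (fun σ _ => ?_) (fun σ _ => ?_) fun σ _ => ?_
  · exact mul_nonneg (div_nonneg (edgeLength_nonneg _) dist_nonneg) (sq_nonneg _)
  · exact mul_nonneg (mul_nonneg (edgeLength_nonneg _) dist_nonneg) (sq_nonneg _)
  · apply le_of_eq
    have := (M.dInner_pos σ).ne'
    rw [trans]
    field_simp

/-- When there is an interior edge, the regularity parameter is at most `1`; otherwise the energy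
vanishes. -/
lemma dirichletEnergy_div_le {ζ : ℝ} (hζ : 0 < ζ) (hreg : M.IsRegular ζ) (f : T → ℝ) :
    M.dirichletEnergy f / ζ ≤ M.dirichletEnergy f / ζ ^ 2 := by
  rcases isEmpty_or_nonempty Eint with h | ⟨⟨σ⟩⟩
  · simp [dirichletEnergy]
  · have hd := M.dInner_pos σ
    have hζd := mul_pos hζ hd
    have h1 := M.distToLine_le_dInner σ (hζd.trans_le (hreg.1 σ).1) (hζd.trans_le (hreg.1 σ).2)
    have h2 : ζ ≤ 1 := by
      have : ζ * M.dInner σ ≤ 1 * M.dInner σ := by linarith [(hreg.1 σ).1]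
      exact le_of_mul_le_mul_right this hd
    exact div_le_div_of_nonneg_left (M.dirichletEnergy_nonneg f) (by positivity) (by nlinarith)

variable [Fintype T]

lemma sum_area [Finite Eext] (hb : Bornology.IsBounded Ω) : ∑ K, M.area K = (volume Ω).toReal := by
  have hfin : ∀ K, volume (M.cell K) ≠ ⊤ := fun K =>
    (hb.subset (M.cell_subset K)).measure_lt_top.ne
  have h1 : volume (⋃ K, M.cell K) = ∑ K, volume (M.cell K) := by
    rw [measure_iUnion (fun K L h => M.cell_disjoint h) fun K => (M.isOpen_cell K).measurableSet,
      tsum_fintype]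
  have h2 : volume Ω = volume (⋃ K, M.cell K) := by
    refine le_antisymm ?_ (measure_mono (iUnion_subset M.cell_subset))
    have hsub : Ω ⊆ (⋃ K, M.cell K) ∪ ⋃ K, frontier (M.cell K) := by
      intro z hz
      obtain ⟨K, hK⟩ := M.exists_mem_closure_cell hz
      rw [closure_eq_self_union_frontier] at hK
      exact hK.imp (fun h => mem_iUnion.2 ⟨K, h⟩) fun h => mem_iUnion.2 ⟨K, h⟩
    refine (measure_mono hsub).trans ((measure_union_le _ _).trans ?_)
    rw [measure_iUnion_null fun K => M.volume_frontier_cell K, add_zero]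
  rw [h2, h1, ENNReal.toReal_sum fun K _ => hfin K]
  rfl

/-- The double sum of the squared differences is the oscillation of the associated piecewise
constant function. -/
lemma ofReal_sum_sum_le_oscillation (hb : Bornology.IsBounded Ω) (u : T → ℝ) :
    ENNReal.ofReal (∑ K, ∑ L, M.area K * M.area L * (u K - u L) ^ 2) ≤
      oscillation (M.value u) Ω Ω := by
  have hfin : ∀ K, volume (M.cell K) ≠ ⊤ := fun K =>
    (hb.subset (M.cell_subset K)).measure_lt_top.ne
  have hmeas : ∀ K, MeasurableSet (M.cell K) := fun K => (M.isOpen_cell K).measurableSet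
  have harea : ∀ K, ENNReal.ofReal (M.area K) = volume (M.cell K) := fun K =>
    ENNReal.ofReal_toReal (hfin K)
  have hsub : (⋃ K, M.cell K) ⊆ Ω := iUnion_subset M.cell_subset
  refine le_trans (le_of_eq ?_) (oscillation_mono _ hsub hsub)
  unfold oscillation
  rw [lintegral_iUnion hmeas fun K L h => M.cell_disjoint h, tsum_fintype,
    ENNReal.ofReal_sum_of_nonneg fun K _ => Finset.sum_nonneg fun L _ =>
      mul_nonneg (mul_nonneg (M.area_nonneg K) (M.area_nonneg L)) (sq_nonneg _)]
  refine Finset.sum_congr rfl fun K _ => ?_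
  have hinner : ∀ z ∈ M.cell K, ∫⁻ w in ⋃ L, M.cell L,
      ENNReal.ofReal ((M.value u z - M.value u w) ^ 2) =
      ∑ L, ENNReal.ofReal ((u K - u L) ^ 2) * volume (M.cell L) := by
    intro z hz
    rw [lintegral_iUnion hmeas fun K L h => M.cell_disjoint h, tsum_fintype]
    refine Finset.sum_congr rfl fun L _ => ?_
    rw [← setLIntegral_const]
    refine setLIntegral_congr_fun (hmeas L) fun w hw => ?_
    rw [M.value_of_mem_cell u hz, M.value_of_mem_cell u hw]
  rw [setLIntegral_congr_fun (hmeas K) hinner, setLIntegral_const, Finset.sum_mul,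
    ENNReal.ofReal_sum_of_nonneg fun L _ =>
      mul_nonneg (mul_nonneg (M.area_nonneg K) (M.area_nonneg L)) (sq_nonneg _)]
  refine Finset.sum_congr rfl fun L _ => ?_
  rw [ENNReal.ofReal_mul (mul_nonneg (M.area_nonneg K) (M.area_nonneg L)),
    ENNReal.ofReal_mul (M.area_nonneg K), harea, harea]
  ring

/-- Regularity replaces `d_σ` by the heights `d(x_K, σ)` of the triangles over the edges, which fit
into the control volumes. -/
lemma sum_edgeLength_mul_dInner_le [Finite Eext] (hb : Bornology.IsBounded Ω) {ζ : ℝ} (hζ : 0 < ζ)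
    (hreg : M.IsRegular ζ) (g : T → ℝ) :
    ∑ σ, edgeLength (M.inner σ) * M.dInner σ * (g (M.left σ) ^ 2 + g (M.right σ) ^ 2) ≤
      (volume unitTriangle).toReal⁻¹ / ζ * ∑ K, M.area K * g K ^ 2 := by
  classical
  set F : T → Eint → ℝ := fun K σ =>
    edgeLength (M.inner σ) * distToLine (M.center K) (M.inner σ) * g K ^ 2 with hF
  have hsum : ∑ σ, (F (M.left σ) σ + F (M.right σ) σ) =
      ∑ K, ∑ σ with M.left σ = K ∨ M.right σ = K, F K σ := by
    simp_rw [Finset.sum_filter]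
    rw [Finset.sum_comm]
    refine Finset.sum_congr rfl fun σ _ => ?_
    rw [← Finset.sum_filter, ← Finset.sum_pair (f := fun K => F K σ) (M.left_ne_right σ)]
    refine Finset.sum_congr ?_ fun _ _ => rfl
    ext K
    simp [eq_comm]
  have hK : ∀ K, ∑ σ with M.left σ = K ∨ M.right σ = K, F K σ ≤
      (volume unitTriangle).toReal⁻¹ * (M.area K * g K ^ 2) := by
    intro K
    rw [hF, ← Finset.sum_mul, ← mul_assoc]
    refine mul_le_mul_of_nonneg_right (M.sum_edgeLength_mul_distToLine_le hb K ?_) (sq_nonneg _)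
    rintro σ (rfl | rfl)
    · exact (mul_pos hζ (M.dInner_pos σ)).trans_le (hreg.1 σ).1
    · exact (mul_pos hζ (M.dInner_pos σ)).trans_le (hreg.1 σ).2
  have hσ : ∀ σ, ζ * (edgeLength (M.inner σ) * M.dInner σ *
      (g (M.left σ) ^ 2 + g (M.right σ) ^ 2)) ≤ F (M.left σ) σ + F (M.right σ) σ := by
    intro σ
    have h0 := edgeLength_nonneg (M.inner σ)
    have h1 := mul_le_mul_of_nonneg_left (hreg.1 σ).1 (mul_nonneg h0 (sq_nonneg (g (M.left σ))))
    have h2 := mul_le_mul_of_nonneg_left (hreg.1 σ).2 (mul_nonneg h0 (sq_nonneg (g (M.right σ))))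
    simp only [hF]
    linarith
  rw [div_mul_eq_mul_div, le_div_iff₀ hζ, mul_comm, Finset.mul_sum]
  calc _ ≤ ∑ σ, (F (M.left σ) σ + F (M.right σ) σ) := Finset.sum_le_sum fun σ _ => hσ σ
    _ ≤ ∑ K, (volume unitTriangle).toReal⁻¹ * (M.area K * g K ^ 2) := by
      rw [hsum]; exact Finset.sum_le_sum fun K _ => hK K
    _ = _ := by rw [← Finset.mul_sum]

lemma variation_sq_le [Finite Eext] (hb : Bornology.IsBounded Ω) {ζ : ℝ} (hζ : 0 < ζ)
    (hreg : M.IsRegular ζ) (f : T → ℝ) :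
    M.variation f ^ 2 ≤
      M.dirichletEnergy f * ((volume unitTriangle).toReal⁻¹ / ζ * (volume Ω).toReal) := by
  have h1 := M.sq_sum_edgeLength_mul_le f fun _ => 1
  simp only [mul_one] at h1
  refine h1.trans (mul_le_mul_of_nonneg_left ?_ (M.dirichletEnergy_nonneg f))
  have h2 := M.sum_edgeLength_mul_dInner_le hb hζ hreg fun _ => 1
  rw [← M.sum_area hb]
  simp only [one_pow, mul_one] at h2 ⊢
  refine le_trans (Finset.sum_le_sum fun σ _ => ?_) h2
  have := mul_nonneg (edgeLength_nonneg (M.inner σ)) (M.dInner_pos σ).le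
  linarith

/-- The variation of `g |g|` is controlled by the energy and by the `L²` norm of `g`. -/
lemma variation_mul_abs_sq_le [Finite Eext] (hb : Bornology.IsBounded Ω) {ζ : ℝ} (hζ : 0 < ζ)
    (hreg : M.IsRegular ζ) (g : T → ℝ) :
    M.variation (fun K => g K * |g K|) ^ 2 ≤ M.dirichletEnergy g *
      (2 * ((volume unitTriangle).toReal⁻¹ / ζ * ∑ K, M.area K * g K ^ 2)) := by
  have hdiff : ∀ x y : ℝ, |x * (|x|) - y * (|y|)| ≤ |x - y| * (|x| + |y|) := by
    intro x y
    have e : x * |x| - y * |y| = ((x - y) * (|x| + |y|) + (x + y) * (|x| - |y|)) / 2 := by ring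
    have h1 : |(x + y) * (|x| - |y|)| ≤ |x - y| * (|x| + |y|) := by
      rw [abs_mul, mul_comm]
      exact mul_le_mul (abs_abs_sub_abs_le_abs_sub x y) (abs_add_le x y) (abs_nonneg _)
        (abs_nonneg _)
    have h2 : |(x - y) * (|x| + |y|)| = |x - y| * (|x| + |y|) := by
      rw [abs_mul, abs_of_nonneg (by positivity : 0 ≤ |x| + |y|)]
    rw [e, abs_div, abs_two]
    have := abs_add_le ((x - y) * (|x| + |y|)) ((x + y) * (|x| - |y|))
    linarith
  have h1 : M.variation (fun K => g K * |g K|) ≤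
      ∑ σ, edgeLength (M.inner σ) * |g (M.left σ) - g (M.right σ)| *
        (|g (M.left σ)| + |g (M.right σ)|) := by
    refine Finset.sum_le_sum fun σ _ => ?_
    rw [mul_assoc]
    exact mul_le_mul_of_nonneg_left (hdiff _ _) (edgeLength_nonneg _)
  refine (pow_le_pow_left₀ (M.variation_nonneg _) h1 2).trans
    ((M.sq_sum_edgeLength_mul_le g _).trans
      (mul_le_mul_of_nonneg_left ?_ (M.dirichletEnergy_nonneg g)))
  refine le_trans ?_ (mul_le_mul_of_nonneg_left (M.sum_edgeLength_mul_dInner_le hb hζ hreg g)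
    zero_le_two)
  rw [Finset.mul_sum]
  refine Finset.sum_le_sum fun σ _ => ?_
  have h0 := mul_nonneg (edgeLength_nonneg (M.inner σ)) (M.dInner_pos σ).le
  have h2 : (|g (M.left σ)| + |g (M.right σ)|) ^ 2 ≤
      2 * (g (M.left σ) ^ 2 + g (M.right σ) ^ 2) := by
    nlinarith [sq_nonneg (|g (M.left σ)| - |g (M.right σ)|), sq_abs (g (M.left σ)),
      sq_abs (g (M.right σ))]
  calc _ ≤ _ := mul_le_mul_of_nonneg_left h2 h0
    _ = _ := by ring

end PolygonalMesh

/-- Discrete Poincaré–Wirtinger and Poincaré–Sobolev inequalities, with constants depending only on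
`Ω`. With `c` a median of `f`, the `BV` inequality is applied to `g = f - c`, then to
`g |g|`, which also has median `0`. -/
lemma exists_discrete_sobolev {Ω : Set Plane} (hΩ : IsOpen Ω) (hc : IsConnected Ω)
    (hb : Bornology.IsBounded Ω) (hp : IsPolygonal Ω) :
    ∃ C₂ C₄ : ℝ, 0 < C₂ ∧ 0 < C₄ ∧
      ∀ (T Eint Eext : Type) [Fintype T] [Fintype Eint] [Fintype Eext]
        (M : PolygonalMesh Ω T Eint Eext) (ζ : ℝ), 0 < ζ → M.IsRegular ζ → ∀ f : T → ℝ, ∃ c : ℝ,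
        ∑ K, M.area K * (f K - c) ^ 2 ≤ C₂ / ζ * M.dirichletEnergy f ∧
        ∑ K, M.area K * (f K - c) ^ 4 ≤ (C₄ / ζ ^ 2 * M.dirichletEnergy f) ^ 2 := by
  obtain ⟨C', hC'top, hC'⟩ := oscControlled_meshFamily hΩ hc.isPreconnected hb hp
  set A := (volume Ω).toReal
  have hA : 0 < A := ENNReal.toReal_pos (hΩ.measure_pos _ hc.nonempty).ne' hb.measure_lt_top.ne
  set κ := (volume unitTriangle).toReal⁻¹ with hκdef
  have hκ : 0 < κ := inv_pos.2
    (ENNReal.toReal_pos volume_unitTriangle_pos.ne' volume_unitTriangle_lt_top.ne)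
  set C := C'.toReal + 1
  have hC : 0 < C := by positivity
  have hbv : ∀ (T Eint Eext : Type) [Fintype T] [Fintype Eint]
      (M : PolygonalMesh Ω T Eint Eext) (u : T → ℝ),
      ∑ K, ∑ L, M.area K * M.area L * (u K - u L) ^ 2 ≤ C * M.variation u ^ 2 := by
    intro T Eint Eext _ _ M u
    have h := (M.ofReal_sum_sum_le_oscillation hb u).trans
      (hC' _ ⟨T, Eint, Eext, inferInstance, inferInstance, M, u, rfl⟩)
    rw [← ENNReal.ofReal_toReal hC'top, ← ENNReal.ofReal_pow (M.variation_nonneg u),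
      ← ENNReal.ofReal_mul ENNReal.toReal_nonneg,
      ENNReal.ofReal_le_ofReal_iff (mul_nonneg ENNReal.toReal_nonneg (sq_nonneg _))] at h
    refine h.trans (mul_le_mul_of_nonneg_right ?_ (sq_nonneg _))
    simp only [C]; linarith
  refine ⟨2 * C * κ, √(8 / A) * (C * κ), by positivity, by positivity, ?_⟩
  intro T Eint Eext _ _ _ M ζ hζ hreg f
  have hsum : ∑ K, M.area K = A := M.sum_area hb
  obtain ⟨c, hc₁, hc₂⟩ := exists_median M.area_nonneg (by rw [hsum]; exact hA) f
  refine ⟨c, ?_⟩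
  set E := M.dirichletEnergy f
  have hE0 : 0 ≤ E := M.dirichletEnergy_nonneg f
  set g : T → ℝ := fun K => f K - c
  have hEg : M.dirichletEnergy g = E := by
    simp only [PolygonalMesh.dirichletEnergy, g, sub_sub_sub_cancel_right, E]
  have hg₁ : (∑ K, M.area K) / 2 ≤ ∑ K with g K ≤ 0, M.area K := by simpa [g] using hc₁
  have hg₂ : (∑ K, M.area K) / 2 ≤ ∑ K with 0 ≤ g K, M.area K := by simpa [g] using hc₂
  have hL2 : ∑ K, M.area K * g K ^ 2 ≤ 2 * C * κ / ζ * E := by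
    have h1 := (half_mul_sum_sq_le M.area_nonneg hg₁ hg₂).trans (hbv _ _ _ M g)
    have h2 := mul_le_mul_of_nonneg_left (M.variation_sq_le hb hζ hreg g) hC.le
    rw [hEg] at h2
    rw [hsum] at h1
    have h3 : A / 2 * ∑ K, M.area K * g K ^ 2 ≤ A / 2 * (2 * C * κ / ζ * E) := by
      calc _ ≤ _ := h1.trans h2
        _ = _ := by simp only [← hκdef]; ring
    exact le_of_mul_le_mul_left h3 (by positivity)
  refine ⟨hL2, ?_⟩
  have hu₁ : (∑ K, M.area K) / 2 ≤ ∑ K with g K * |g K| ≤ 0, M.area K := by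
    refine hg₁.trans (Finset.sum_le_sum_of_subset_of_nonneg (fun K hK => ?_)
      fun K _ _ => M.area_nonneg K)
    simp only [Finset.mem_filter, Finset.mem_univ, true_and] at hK ⊢
    exact mul_nonpos_of_nonpos_of_nonneg hK (abs_nonneg _)
  have hu₂ : (∑ K, M.area K) / 2 ≤ ∑ K with 0 ≤ g K * |g K|, M.area K := by
    refine hg₂.trans (Finset.sum_le_sum_of_subset_of_nonneg (fun K hK => ?_)
      fun K _ _ => M.area_nonneg K)
    simp only [Finset.mem_filter, Finset.mem_univ, true_and] at hK ⊢
    exact mul_nonneg hK (abs_nonneg _)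
  have h1 := (half_mul_sum_sq_le M.area_nonneg hu₁ hu₂).trans (hbv _ _ _ M _)
  have h2 := mul_le_mul_of_nonneg_left (M.variation_mul_abs_sq_le hb hζ hreg g) hC.le
  rw [hEg, ← hκdef] at h2
  rw [hsum] at h1
  have hpow : ∀ K, (g K * |g K|) ^ 2 = g K ^ 4 := by
    intro K; rw [mul_pow, sq_abs]; ring
  simp_rw [hpow] at h1
  have h3 : A / 2 * ∑ K, M.area K * g K ^ 4 ≤ A / 2 * (√(8 / A) * (C * κ) * (E / ζ)) ^ 2 := by
    calc _ ≤ _ := h1.trans h2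
      _ ≤ C * (E * (2 * (κ / ζ * (2 * C * κ / ζ * E)))) := by gcongr
      _ = _ := by
        rw [mul_pow, mul_pow, Real.sq_sqrt (by positivity)]
        field_simp
        ring
  refine (le_of_mul_le_mul_left h3 (by positivity)).trans ?_
  have h4 := M.dirichletEnergy_div_le hζ hreg f
  have h5 : √(8 / A) * (C * κ) / ζ ^ 2 * E = √(8 / A) * (C * κ) * (E / ζ ^ 2) := by ring
  rw [h5]
  gcongr

end FiniteVolume

theorem proposition5p2 (Ω : Set FiniteVolume.Plane) (hΩ_open : IsOpen Ω)
    (hΩ_conn : IsConnected Ω) (hΩ_bdd : Bornology.IsBounded Ω)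
    (hΩ_poly : FiniteVolume.IsPolygonal Ω) :
    ∃ C_LS C_B : ℝ, 0 < C_LS ∧ 0 < C_B ∧
      ∀ (T Eint Eext : Type) [Fintype T] [Fintype Eint] [Fintype Eext]
        (M : FiniteVolume.PolygonalMesh Ω T Eint Eext) (ζ : ℝ), 0 < ζ → M.IsRegular ζ →
      ∀ (v vinf : T → ℝ) (M₁ : ℝ), (∀ K, 0 < v K) → (∀ K, 0 < vinf K) →
        ∑ K, M.area K * v K = M₁ → ∑ K, M.area K * vinf K = M₁ →
        M.relEntropy FiniteVolume.boltzmannPhi v vinf ≤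
            C_LS / ζ ^ 2 * Real.sqrt (M₁ * ⨆ K, vinf K) *
              M.dirichletEnergy (fun K => Real.sqrt (v K / vinf K)) ∧
        ∀ p : ℝ, 1 < p → p ≤ 2 →
          M.relEntropy (FiniteVolume.tsallisPhi p) v vinf ≤
            C_B / ((p - 1) * ζ) * (⨆ K, vinf K) *
              M.dirichletEnergy (fun K => (v K / vinf K) ^ (p / 2)) := by
  obtain ⟨C₂, C₄, hC₂, hC₄, hSob⟩ := FiniteVolume.exists_discrete_sobolev hΩ_open hΩ_conn hΩ_bdd hΩ_poly
  refine ⟨16 * C₄, C₂, by positivity, hC₂, ?_⟩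
  intro T Eint Eext _ _ _ M ζ hζ hreg v vinf M₁ hv hvinf hM hMinf
  have hT : Nonempty T := by
    obtain ⟨z, hz⟩ := hΩ_conn.nonempty
    exact ⟨(M.exists_mem_closure_cell hz).choose⟩
  set V := ⨆ K, vinf K
  have hV : ∀ K, vinf K ≤ V := fun K => le_ciSup (Set.finite_range vinf).bddAbove K
  have hV0 : 0 < V := (hvinf hT.some).trans_le (hV _)
  have hM₁ : 0 < M₁ := by
    rw [← hM]
    exact Finset.sum_pos (fun K _ => mul_pos (M.area_pos hΩ_bdd K) (hv K)) Finset.univ_nonempty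
  set μ : T → ℝ := fun K => M.area K * vinf K
  set h : T → ℝ := fun K => v K / vinf K
  have hμ : ∀ K, 0 ≤ μ K := fun K => mul_nonneg (M.area_nonneg K) (hvinf K).le
  have hh : ∀ K, 0 < h K := fun K => div_pos (hv K) (hvinf K)
  have hμh : ∑ K, μ K * h K = M₁ := by
    rw [← hM]
    refine Finset.sum_congr rfl fun K _ => ?_
    have := (hvinf K).ne'
    simp only [μ, h]
    field_simp
  have hent : ∀ Φ : ℝ → ℝ, M.relEntropy Φ v vinf = ∑ K, μ K * Φ (h K) := fun Φ =>
    Finset.sum_congr rfl fun K _ => by simp only [μ, h]; ring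
  have hμV : ∀ F : T → ℝ, (∀ K, 0 ≤ F K) → ∑ K, μ K * F K ≤ V * ∑ K, M.area K * F K := by
    intro F hF
    rw [Finset.mul_sum]
    refine Finset.sum_le_sum fun K _ => ?_
    have := mul_le_mul_of_nonneg_right (hV K) (mul_nonneg (M.area_nonneg K) (hF K))
    simp only [μ]
    linarith
  constructor
  · obtain ⟨c, -, hc⟩ := hSob T Eint Eext M ζ hζ hreg fun K => √(h K)
    set X := C₄ / ζ ^ 2 * M.dirichletEnergy fun K => √(h K) with hX
    have hX0 : 0 ≤ X := mul_nonneg (by positivity) (M.dirichletEnergy_nonneg _)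
    rw [hent]
    calc ∑ K, μ K * FiniteVolume.boltzmannPhi (h K)
        ≤ 16 * √(M₁ * ∑ K, μ K * (√(h K) - c) ^ 4) := FiniteVolume.sum_boltzmannPhi_le hμ hh hM₁ hMinf hμh
      _ ≤ 16 * √(M₁ * V * X ^ 2) := by
          refine mul_le_mul_of_nonneg_left (Real.sqrt_le_sqrt ?_) (by norm_num)
          rw [mul_assoc]
          exact mul_le_mul_of_nonneg_left ((hμV _ fun K => by positivity).trans
            (mul_le_mul_of_nonneg_left hc hV0.le)) hM₁.le
      _ = 16 * C₄ / ζ ^ 2 * √(M₁ * V) * M.dirichletEnergy fun K => √(h K) := by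
          rw [Real.sqrt_mul (by positivity), Real.sqrt_sq hX0, hX]; ring
  · intro p hp hp'
    have hp0 : 0 < p - 1 := by linarith
    obtain ⟨c, hc, -⟩ := hSob T Eint Eext M ζ hζ hreg fun K => h K ^ (p / 2)
    rw [hent]
    calc ∑ K, μ K * FiniteVolume.tsallisPhi p (h K)
        ≤ (p - 1)⁻¹ * ∑ K, μ K * (h K ^ (p / 2) - c) ^ 2 :=
          FiniteVolume.sum_tsallisPhi_le hμ hh hMinf hμh hp hp'
      _ ≤ (p - 1)⁻¹ * (V * (C₂ / ζ * M.dirichletEnergy fun K => h K ^ (p / 2))) := by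
          gcongr
          exact (hμV _ fun K => sq_nonneg _).trans (mul_le_mul_of_nonneg_left hc hV0.le)
      _ = C₂ / ((p - 1) * ζ) * V * M.dirichletEnergy fun K => h K ^ (p / 2) := by
          field_simp
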